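/- **Setting.** Let $Y$ be a real-valued random variable and $\mathbf X$ an $\mathbb R^p$-valued random vector on a probability space $(\Omega,\mathcal A,P)$. Write $F_Y(y)=P(Y\le y)$, $q_Y(v)=\inf\{y : F_Y(y)\ge v\}$ for $v\in(0,1)$, and $F_{Y|\mathbf X=\mathbf x}(y)=P(Y\le y\mid \mathbf X=\mathbf x)$ (via a regular conditional distribution). For random vectors $(Y,\mathbf X)$ and $(Y',\mathbf X')$, with $\mathbf X,\mathbf X'$ of possibly different dimensions, the conditional convex order $(Y,\mathbf X)\preccurlyeq_{ccx}(Y',\mathbf X')$ means that, for every $v\in(0,1)$, $$P(Y\ge q_Y(v)\mid \mathbf X)\ \le_{cx}\ P(Y'\ge q_{Y'}(v)\mid \mathbf X'),$$ where $S\le_{cx}T$ for bounded random variables means $\mathbb E\,\psi(S)\le \mathbb E\,\psi(T)$ for all convex $\psi:\mathbb R\to\mathbb R$. For $\varphi:[-1,1]\to\mathbb R$ put $$\xi_\varphi(Y,\mathbf X)=\alpha_\varphi^{-1}\int_{\mathbb R^p}\int_{\mathbb R}\varphi\big(F_{Y|\mathbf X=\mathbf x}(y)-F_Y(y)\big)\,dP^Y(y)\,dP^{\mathbf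 X}(\mathbf x),$$ $$\Lambda_\varphi(Y,\mathbf X)=\beta_\varphi^{-1}\int_{\mathbb R^{2p}}\int_{\mathbb R}\varphi\big(F_{Y|\mathbf X=\mathbf x_1}(y)-F_{Y|\mathbf X=\mathbf x_2}(y)\big)\,dP^Y(y)\,d(P^{\mathbf X}\otimes P^{\mathbf X})(\mathbf x_1,\mathbf x_2),$$ with normalizing constants $$\alpha_\varphi=\int_{\mathbb R}\int_{\mathbb R}\varphi\big(\mathbf 1_{\{y_1\le y\}}-F_Y(y)\big)\,dP^Y(y)\,dP^Y(y_1),$$ $$\beta_\varphi=\int_{\mathbb R^2}\int_{\mathbb R}\varphi\big(\mathbf 1_{\{y_1\le y\}}-\mathbf 1_{\{y_2\le y\}}\big)\,dP^Y(y)\,d(P^Y\otimes P^Y)(y_1,y_2).$$ **Theorem.** Let $\varphi:[-1,1]\to\mathbb R$ be convex with $\varphi(0)=0$, and strictly convex at $0$: $0<a\varphi(s)+b\varphi(t)$ whenever $s\ne t$ in $[-1,1]$, $a,b>0$, $a+b=1$ and $as+bt=0$. Assume that $Y$ is non-degenerate (not almost surely constant). Then $(Y,\mathbf X)\preccurlyeq_{ccx}(Y',\mathbf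 X')$ implies $$\xi_\varphi(Y,\mathbf X)\le \xi_\varphi(Y',\mathbf X')\quad\text{and}\quad \Lambda_\varphi(Y,\mathbf X)\le\Lambda_\varphi(Y',\mathbf X').$$ Further: (i) $\xi_\varphi(Y,\mathbf X)\in[0,1]$ and $\Lambda_\varphi(Y,\mathbf X)\in[0,1]$. (ii) $\xi_\varphi(Y,\mathbf X)=0$ if and only if $\mathbf X$ and $Y$ are independent, and $\xi_\varphi(Y,\mathbf X)=1$ if and only if $Y=f(\mathbf X)$ almost surely for some measurable function $f$; the same two equivalences hold for $\Lambda_\varphi$. (iii) If $\varphi$ is strictly convex on $[-1,1]$, then for every random vector $\mathbf Z$ on $\Omega$ (of arbitrary finite dimension) the following are equivalent: $\Lambda_\varphi(Y,\mathbf X)=\Lambda_\varphi(Y,(\mathbf X,\mathbf Z))$; $\xi_\varphi(Y,\mathbf X)=\xi_\varphi(Y,(\mathbf X,\mathbf Z))$; $Y$ and $\mathbf Z$ are conditionally independent given $\mathbf X$. -/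

import Mathlib

open MeasureTheory ProbabilityTheory

noncomputable section

namespace DepMeasure

/-- Strict convexity of `φ` on `s` at the single point `c`: whenever `c` is a proper convex
combination of two distinct points of `s`, the convexity inequality at `c` is strict. -/
def StrictConvexOnAt (s : Set ℝ) (φ : ℝ → ℝ) (c : ℝ) : Prop :=
  ∀ x ∈ s, ∀ y ∈ s, x ≠ y → ∀ a b : ℝ, 0 < a → 0 < b → a + b = 1 → a * x + b * y = c →
    φ c < a * φ x + b * φ y

section RandomVectors

variable {Ω : Type*} [MeasurableSpace Ω] {E : Type*} [MeasurableSpace E]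
  {G : Type*} [MeasurableSpace G]

/-- The distribution function `F_Y(y) = P(Y ≤ y)`. -/
def distFun (P : Measure Ω) (Y : Ω → ℝ) (y : ℝ) : ℝ :=
  cdf (P.map Y) y

/-- The left-continuous quantile function `q_Y(v) = inf {y | F_Y(y) ≥ v}`, for `0 < v < 1`. -/
def quantile (P : Measure Ω) (Y : Ω → ℝ) (v : ℝ) : ℝ :=
  sInf {y : ℝ | v ≤ distFun P Y y}

/-- The conditional distribution function `F_{Y|X=x}(y) = P(Y ≤ y | X = x)`, through the regular
conditional distribution of `Y` given `X`. -/
def condDistFun (P : Measure Ω) [IsFiniteMeasure P] (Y : Ω → ℝ) (X : Ω → E) (x : E) (y : ℝ) : ℝ :=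
  (condDistrib Y X P x).real (Set.Iic y)

/-- The random variable `P(Y ≥ y | X)`. -/
def condSurvival (P : Measure Ω) [IsFiniteMeasure P] (Y : Ω → ℝ) (X : Ω → E) (y : ℝ) (ω : Ω) : ℝ :=
  (condDistrib Y X P (X ω)).real (Set.Ici y)

/-- The random variable `Y` is degenerate: almost surely constant. -/
def Degenerate (P : Measure Ω) (Y : Ω → ℝ) : Prop :=
  ∃ c : ℝ, Y =ᵐ[P] fun _ => c

/-- `Y` is perfectly (functionally) dependent on `X`: `Y = f(X)` almost surely for some
measurable `f`. -/
def PerfectlyDependent (P : Measure Ω) (Y : Ω → ℝ) (X : Ω → E) : Prop :=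
  ∃ f : E → ℝ, Measurable f ∧ Y =ᵐ[P] fun ω => f (X ω)

/-- `Y` and `Z` are conditionally independent given `X`, on an arbitrary probability space:
`P(Y ∈ A, Z ∈ B | X) = P(Y ∈ A | X) P(Z ∈ B | X)` almost surely, for all measurable `A`, `B`. -/
def CondIndepGiven (P : Measure Ω) (Y : Ω → ℝ) (Z : Ω → G) (X : Ω → E) : Prop :=
  ∀ (A : Set ℝ) (B : Set G), MeasurableSet A → MeasurableSet B →
    P⟦Y ⁻¹' A ∩ Z ⁻¹' B | MeasurableSpace.comap X inferInstance⟧ =ᵐ[P] fun ω =>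
      (P⟦Y ⁻¹' A | MeasurableSpace.comap X inferInstance⟧) ω *
        (P⟦Z ⁻¹' B | MeasurableSpace.comap X inferInstance⟧) ω

/-- `α_φ = ∫ ∫ φ(1{y₁ ≤ y} - F_Y(y)) dP^Y(y) dP^Y(y₁)`. -/
def alphaPhi (φ : ℝ → ℝ) (P : Measure Ω) (Y : Ω → ℝ) : ℝ :=
  ∫ y₁, ∫ y, φ ((Set.Iic y).indicator (fun _ => (1 : ℝ)) y₁ - distFun P Y y) ∂(P.map Y)
    ∂(P.map Y)

/-- `β_φ = ∫ ∫ φ(1{y₁ ≤ y} - 1{y₂ ≤ y}) dP^Y(y) d(P^Y ⊗ P^Y)(y₁, y₂)`. -/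
def betaPhi (φ : ℝ → ℝ) (P : Measure Ω) (Y : Ω → ℝ) : ℝ :=
  ∫ z : ℝ × ℝ, ∫ y, φ ((Set.Iic y).indicator (fun _ => (1 : ℝ)) z.1
      - (Set.Iic y).indicator (fun _ => (1 : ℝ)) z.2) ∂(P.map Y)
    ∂((P.map Y).prod (P.map Y))

/-- `ξ_φ(Y, X) = α_φ⁻¹ ∫ ∫ φ(F_{Y|X=x}(y) - F_Y(y)) dP^Y(y) dP^X(x)`. -/
def xiPhi (φ : ℝ → ℝ) (P : Measure Ω) [IsFiniteMeasure P] (Y : Ω → ℝ) (X : Ω → E) : ℝ :=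
  (alphaPhi φ P Y)⁻¹ *
    ∫ x, ∫ y, φ (condDistFun P Y X x y - distFun P Y y) ∂(P.map Y) ∂(P.map X)

/-- `Λ_φ(Y, X) = β_φ⁻¹ ∫ ∫ φ(F_{Y|X=x₁}(y) - F_{Y|X=x₂}(y)) dP^Y(y) d(P^X ⊗ P^X)(x₁, x₂)`. -/
def lambdaPhi (φ : ℝ → ℝ) (P : Measure Ω) [IsFiniteMeasure P] (Y : Ω → ℝ) (X : Ω → E) : ℝ :=
  (betaPhi φ P Y)⁻¹ *
    ∫ z : E × E, ∫ y, φ (condDistFun P Y X z.1 y - condDistFun P Y X z.2 y) ∂(P.map Y)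
      ∂((P.map X).prod (P.map X))

end RandomVectors

section Orders

variable {Ω : Type*} [MeasurableSpace Ω] {Ω' : Type*} [MeasurableSpace Ω']
  {E : Type*} [MeasurableSpace E] {E' : Type*} [MeasurableSpace E']

/-- The convex order `S ≤_cx T` of bounded random variables. -/
def ConvexOrder (P : Measure Ω) (S : Ω → ℝ) (P' : Measure Ω') (T : Ω' → ℝ) : Prop :=
  ∀ ψ : ℝ → ℝ, ConvexOn ℝ Set.univ ψ → ∫ ω, ψ (S ω) ∂P ≤ ∫ ω, ψ (T ω) ∂P'

/-- The conditional convex order `(Y, X) ≼_ccx (Y', X')`: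
`P(Y ≥ q_Y(v) | X) ≤_cx P(Y' ≥ q_{Y'}(v) | X')` for all `v ∈ (0, 1)`. -/
def CondConvexOrder (P : Measure Ω) [IsFiniteMeasure P] (Y : Ω → ℝ) (X : Ω → E)
    (P' : Measure Ω') [IsFiniteMeasure P'] (Y' : Ω' → ℝ) (X' : Ω' → E') : Prop :=
  ∀ v ∈ Set.Ioo (0 : ℝ) 1,
    ConvexOrder P (condSurvival P Y X (quantile P Y v))
      P' (condSurvival P' Y' X' (quantile P' Y' v))

end Orders

end DepMeasure

end

/-! By Fubini both functionals are averages over levels $y\sim P^Y$. At level $y$ only the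
$[0,1]$-valued variable $S=F_{Y|X}(y)$ enters; its mean is $m=F_Y(y)$. The numerators average
$\mathbb E\varphi(S-m)$ and $\mathbb E\varphi(S-S')$, with $S'$ an independent copy of $S$.

Range and extremal cases. Both arguments of $\varphi$ are centred, so Jensen at $0$ gives
nonnegativity, with equality iff $S=m$ a.s. (`integral_convex_centered`). Chords give upper bounds
that are attained iff $S\in\{0,1\}$ a.s., and these bounds are exactly the integrands of
$\alpha_\varphi$ and $\beta_\varphi$. A property of $S$ at $P^Y$-almost all levels extends to all
levels by limits from below (`forall_of_ae_of_limit`). Hence $S=m$ means independence, and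
$S\in\{0,1\}$ means that the conditional laws are Dirac, that is $Y=f(X)$.

Monotonicity. With $y=q_Y(v)$ the averages become integrals over $v\in(0,1)$. Testing the order with
$\pm\mathrm{id}$ gives equal $P(Y<q_Y(v))$ and $P(Y'<q_{Y'}(v))$, hence equal $F(q(v))$ outside
countably many $v$, hence equal normalizers. Letting the level decrease to $F(q(v))$ turns the order
of the survival variables $P(Y\ge q\mid X)$ into the convex order of $F_{Y|X}(q_Y(v))$
(`CondConvexOrder.convexOrder_condDistFun`). Convex order is preserved by shifts and by subtracting
independent copies. Since $\varphi$ may jump at $\pm1$, it is reached from convex functions on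
$\mathbb R$ by bounded pointwise approximation.

Conditional independence. $F_{Y|X}(y)$ is the conditional expectation given $X$ of $F_{Y|(X,Z)}(y)$,
and also of the midpoint of the two. Under strict convexity, equal functionals squeeze the value at
the midpoint and force both variables to agree, which is conditional independence. -/

noncomputable section

namespace DepMeasure

open Set Filter Topology

/-! ### Convex functions on the interval [-1, 1] -/

section ConvexAnalysis

variable {φ : ℝ → ℝ}

lemma exists_supporting_slope {s : Set ℝ} (hφ : ConvexOn ℝ s φ) {t : ℝ} (ht : t ∈ interior s) :
    ∃ c, ∀ u ∈ s, φ t + c * (u - t) ≤ φ u := by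
  refine ⟨derivWithin φ (Ioi t) t, fun u hu => ?_⟩
  rcases lt_trichotomy u t with h | h | h
  · have h1 := hφ.slope_le_leftDeriv_of_mem_interior hu ht h
    have h2 := h1.trans (hφ.leftDeriv_le_rightDeriv_of_mem_interior ht)
    rw [slope_def_field, div_le_iff₀ (by linarith)] at h2
    linarith
  · simp [h]
  · have h1 := hφ.rightDeriv_le_slope_of_mem_interior ht hu h
    rw [slope_def_field, le_div_iff₀ (by linarith)] at h1
    linarith

/-- The chord between the endpoints bounds `φ` above; reflection, through `φ 0 ≤ (φ t + φ (-t)) /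
2`, turns this into a lower bound. -/
lemma exists_abs_le_of_convexOn (hφ : ConvexOn ℝ (Icc (-1) 1) φ) :
    ∃ C, 0 < C ∧ ∀ t ∈ Icc (-1 : ℝ) 1, |φ t| ≤ C := by
  have hub : ∀ t ∈ Icc (-1 : ℝ) 1, φ t ≤ |φ 1| + |φ (-1)| := by
    intro t ht
    have h := hφ.2 (show (1 : ℝ) ∈ Icc (-1 : ℝ) 1 by norm_num)
      (show (-1 : ℝ) ∈ Icc (-1 : ℝ) 1 by norm_num)
      (show 0 ≤ (1 + t) / 2 by linarith [ht.1]) (show 0 ≤ (1 - t) / 2 by linarith [ht.2])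
      (by ring)
    simp only [smul_eq_mul] at h
    rw [show (1 + t) / 2 * 1 + (1 - t) / 2 * (-1) = t by ring] at h
    have h1 := le_abs_self (φ 1)
    have h2 := le_abs_self (φ (-1))
    have h3 := abs_nonneg (φ 1)
    have h4 := abs_nonneg (φ (-1))
    nlinarith [ht.1, ht.2]
  refine ⟨|φ 1| + |φ (-1)| + 2 * |φ 0| + 1, by positivity, fun t ht => abs_le.2 ⟨?_, ?_⟩⟩
  · have ht' : -t ∈ Icc (-1 : ℝ) 1 := ⟨by linarith [ht.2], by linarith [ht.1]⟩
    have h := hφ.2 ht ht' (show (0 : ℝ) ≤ 1 / 2 by norm_num) (show (0 : ℝ) ≤ 1 / 2 by norm_num)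
      (by norm_num)
    simp only [smul_eq_mul] at h
    rw [show 1 / 2 * t + 1 / 2 * -t = 0 by ring] at h
    have := hub _ ht'
    have := neg_abs_le (φ 0)
    linarith
  · have := hub _ ht
    have := abs_nonneg (φ 0)
    linarith

/-- A convex function on `[-1, 1]`, possibly discontinuous at the endpoints, is a bounded pointwise
limit of finite convex functions on the real line. -/
lemma exists_convexOn_univ_approx (hφ : ConvexOn ℝ (Icc (-1) 1) φ) :
    ∃ (h : ℕ → ℝ → ℝ) (C : ℝ), (∀ n, ConvexOn ℝ univ (h n)) ∧
      (∀ n, ∀ t ∈ Icc (-1 : ℝ) 1, |h n t| ≤ C) ∧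
      ∀ t ∈ Icc (-1 : ℝ) 1, Tendsto (fun n => h n t) atTop (𝓝 (φ t)) := by
  obtain ⟨C, hC, hb⟩ := exists_abs_le_of_convexOn hφ
  -- The thin gaps next to `±1` are left out, so that a steep line can pass through the value at an
  -- endpoint, even if `φ` jumps there. `h n` is the supremum of the affine functions below `φ` on
  -- `S n`; the slope cap keeps it finite on all of ℝ.
  let S : ℕ → Set ℝ := fun n => {u | u ∈ Icc (-1 : ℝ) 1 ∧ (|u| = 1 ∨ |u| ≤ 1 - 1 / ((n : ℝ) + 1))}
  let L : ℕ → Set (ℝ × ℝ) := fun n =>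
    {p | |p.2| ≤ 2 * C * ((n : ℝ) + 1) ∧ ∀ u ∈ S n, p.1 + p.2 * u ≤ φ u}
  let h : ℕ → ℝ → ℝ := fun n t => ⨆ p : L n, (p.1.1 + p.1.2 * t)
  have hS1 : ∀ n, (1 : ℝ) ∈ S n := fun n => ⟨by norm_num, Or.inl (by norm_num)⟩
  have hSm : ∀ n, (-1 : ℝ) ∈ S n := fun n => ⟨by norm_num, Or.inl (by norm_num)⟩
  have hS0 : ∀ n, (0 : ℝ) ∈ S n := fun n => ⟨by norm_num, Or.inr (by
    rw [abs_zero, sub_nonneg, div_le_one (by positivity)]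
    have : (0 : ℝ) ≤ n := n.cast_nonneg
    linarith)⟩
  have hmem : ∀ n, (-C, (0 : ℝ)) ∈ L n := fun n => ⟨by simp; positivity, fun u hu => by
    have := (abs_le.1 (hb u hu.1)).1
    simpa using this⟩
  have hne : ∀ n, Nonempty (L n) := fun n => ⟨⟨_, hmem n⟩⟩
  have hbdd : ∀ n t, BddAbove (range fun p : L n => p.1.1 + p.1.2 * t) := by
    intro n t
    refine ⟨C + 2 * C * (n + 1) * |t|, ?_⟩
    rintro _ ⟨p, rfl⟩
    have h0 := p.2.2 0 (hS0 n)
    have h1 := (abs_le.1 (hb 0 (by norm_num))).2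
    have h2 : p.1.2 * t ≤ 2 * C * (n + 1) * |t| :=
      (le_abs_self _).trans (by rw [abs_mul]; gcongr; exact p.2.1)
    simp only
    linarith
  have hle : ∀ n t x, (∀ p ∈ L n, p.1 + p.2 * t ≤ x) → h n t ≤ x := fun n t x hx =>
    ciSup_le fun p => hx _ p.2
  have hge : ∀ n t p, p ∈ L n → p.1 + p.2 * t ≤ h n t := fun n t p hp =>
    le_ciSup (hbdd n t) ⟨p, hp⟩
  have heq1 : ∀ n t, (t = 1 ∨ t = -1) → h n t = φ t := by
    intro n t ht
    have hn : (0 : ℝ) < (n : ℝ) + 1 := by positivity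
    have htt : t * t = 1 := by rcases ht with rfl | rfl <;> norm_num
    refine le_antisymm (hle _ _ _ fun p hp => hp.2 t ?_) ?_
    · rcases ht with rfl | rfl
      exacts [hS1 n, hSm n]
    · have hp : (φ t - 2 * C * (n + 1), 2 * C * (n + 1) * t) ∈ L n := by
        refine ⟨?_, fun u hu => ?_⟩
        · rw [abs_mul, abs_of_nonneg (by positivity)]
          rcases ht with rfl | rfl <;> simp
        · have hK : 0 ≤ 2 * C * ((n : ℝ) + 1) := by positivity
          have hu1 := (abs_le.1 (hb u hu.1)).1
          have ht1 : φ t ≤ C := (abs_le.1 (hb t (by rcases ht with rfl | rfl <;> norm_num))).2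
          by_cases hut : u = t
          · subst hut
            simp only
            nlinarith
          · have key : t * u ≤ 1 - 1 / ((n : ℝ) + 1) := by
              have h1n : 1 / ((n : ℝ) + 1) ≤ 1 := by
                rw [div_le_one hn]
                have : (0 : ℝ) ≤ n := n.cast_nonneg
                linarith
              rcases hu.2 with h | h
              · have : t * u = -1 := by
                  rcases ht with rfl | rfl <;>
                    rcases (abs_eq (by norm_num : (0 : ℝ) ≤ 1)).1 h with rfl | rfl <;>
                    first
                      | exact absurd rfl hut
                      | norm_num
                linarith
              · refine le_trans (le_trans (le_abs_self _) ?_) h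
                rw [abs_mul]
                rcases ht with rfl | rfl <;> simp
            have : 2 * C * ((n : ℝ) + 1) * (t * u) ≤ 2 * C * (n + 1) - 2 * C := by
              calc _ ≤ 2 * C * ((n : ℝ) + 1) * (1 - 1 / ((n : ℝ) + 1)) := by gcongr
                _ = _ := by field_simp
            simp only
            nlinarith
      have := hge n t _ hp
      simp only at this
      rw [mul_assoc _ t t, htt] at this
      linarith
  refine ⟨h, C, fun n => ⟨convex_univ, fun x _ y _ a b ha hb' hab => ?_⟩, fun n t ht => ?_,
    fun t ht => ?_⟩
  · simp only [smul_eq_mul]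
    refine hle _ _ _ fun p hp => ?_
    have h1 := mul_le_mul_of_nonneg_left (hge n x p hp) ha
    have h2 := mul_le_mul_of_nonneg_left (hge n y p hp) hb'
    have : p.1 = a * p.1 + b * p.1 := by rw [← add_mul, hab, one_mul]
    linarith
  · refine abs_le.2 ⟨?_, ?_⟩
    · simpa using hge n t _ (hmem n)
    · refine hle _ _ _ fun p hp => ?_
      have h1 := hp.2 1 (hS1 n)
      have h2 := hp.2 (-1) (hSm n)
      have h3 := (abs_le.1 (hb 1 (by norm_num))).2
      have h4 := (abs_le.1 (hb (-1) (by norm_num))).2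
      nlinarith [ht.1, ht.2]
  -- The approximation is eventually exact at each point: at an interior `t` the supporting line has
  -- slope at most `2 * C / (1 - |t|)`, hence is admissible for large `n`.
  · refine tendsto_const_nhds.congr' ?_
    by_cases hte : t = 1 ∨ t = -1
    · exact Eventually.of_forall fun n => (heq1 n t hte).symm
    push Not at hte
    have ht1 : t < 1 := lt_of_le_of_ne ht.2 hte.1
    have ht2 : -1 < t := lt_of_le_of_ne ht.1 (Ne.symm hte.2)
    obtain ⟨c, hc⟩ := exists_supporting_slope hφ (t := t) (by rw [interior_Icc]; exact ⟨ht2, ht1⟩)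
    have habs : 0 < 1 - |t| := sub_pos.2 (abs_lt.2 ⟨ht2, ht1⟩)
    obtain ⟨N, hN⟩ := exists_nat_one_div_lt habs
    filter_upwards [eventually_ge_atTop N] with n hn
    have hn' : 1 / ((n : ℝ) + 1) < 1 - |t| := lt_of_le_of_lt (by gcongr) hN
    refine le_antisymm ?_ (hle _ _ _ fun p hp => hp.2 t ⟨ht, Or.inr (by linarith)⟩)
    have hp : (φ t - c * t, c) ∈ L n := by
      refine ⟨?_, fun u hu => by have := hc u hu.1; simp only; linarith⟩
      have hn0 : (0 : ℝ) < (n : ℝ) + 1 := by positivity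
      rw [div_lt_iff₀ hn0] at hn'
      have e1 := hc 1 (by norm_num)
      have e2 := hc (-1) (by norm_num)
      have b1 := (abs_le.1 (hb 1 (by norm_num))).2
      have b2 := (abs_le.1 (hb (-1) (by norm_num))).2
      have b3 := (abs_le.1 (hb t ht)).1
      have l1 := le_abs_self t
      have l2 := neg_abs_le t
      have hcb : |c| * (1 - |t|) ≤ 2 * C := by
        rcases abs_cases c with ⟨hc1, hc2⟩ | ⟨hc1, hc2⟩ <;> rw [hc1] <;> nlinarith
      have : |c| * 1 ≤ |c| * ((1 - |t|) * (n + 1)) := by gcongr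
      simp only
      nlinarith
    have := hge n t _ hp
    simp only at this
    linarith

/-- On `[-1, 1]` the function `φ` is a pointwise limit of continuous functions; nothing is known of
it elsewhere, so only compositions with values in the interval are controlled. -/
lemma measurable_convexOn_comp (hφ : ConvexOn ℝ (Icc (-1) 1) φ) {α : Type*} [MeasurableSpace α]
    {U : α → ℝ} (hU : Measurable U) (hU1 : ∀ x, U x ∈ Icc (-1 : ℝ) 1) :
    Measurable fun x => φ (U x) := by
  obtain ⟨h, C, hc, -, ht⟩ := exists_convexOn_univ_approx hφ
  have hm : ∀ n, Measurable (h n) := fun n => (hc n).locallyLipschitz.continuous.measurable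
  exact measurable_of_tendsto_metrizable (fun n => (hm n).comp hU)
    (tendsto_pi_nhds.2 fun x => ht _ (hU1 x))

lemma integrable_convexOn_comp (hφ : ConvexOn ℝ (Icc (-1) 1) φ) {α : Type*} [MeasurableSpace α]
    {μ : Measure α} [IsFiniteMeasure μ]
    {U : α → ℝ} (hU : Measurable U) (hU1 : ∀ x, U x ∈ Icc (-1 : ℝ) 1) :
    Integrable (fun x => φ (U x)) μ := by
  obtain ⟨C, -, hC⟩ := exists_abs_le_of_convexOn hφ
  exact Integrable.of_bound (measurable_convexOn_comp hφ hU hU1).aestronglyMeasurable C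
    (Eventually.of_forall fun x => hC _ (hU1 x))

end ConvexAnalysis

/-! ### Chord inequalities and their strict forms -/

section Inequalities

variable {φ : ℝ → ℝ}

lemma StrictConvexOnAt.two_point_pos (hs : StrictConvexOnAt (Icc (-1) 1) φ 0) (h0 : φ 0 = 0)
    {t : ℝ} (ht : t ∈ Ioo (0 : ℝ) 1) : 0 < t * φ (1 - t) + (1 - t) * φ (-t) := by
  have := hs (1 - t) ⟨by linarith [ht.2], by linarith [ht.1]⟩ (-t)
    ⟨by linarith [ht.2], by linarith [ht.1]⟩ (by linarith) t (1 - t) ht.1 (by linarith [ht.2])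
    (by ring) (by ring)
  rwa [h0] at this

lemma StrictConvexOnAt.endpoints_pos (hs : StrictConvexOnAt (Icc (-1) 1) φ 0) (h0 : φ 0 = 0) :
    0 < φ 1 + φ (-1) := by
  have := hs 1 (by norm_num) (-1) (by norm_num) (by norm_num) (1 / 2) (1 / 2) (by norm_num)
    (by norm_num) (by norm_num) (by norm_num)
  rw [h0] at this
  linarith

lemma convexOn_sub_le_two_point (hφ : ConvexOn ℝ (Icc (-1) 1) φ) {p t : ℝ}
    (hp : p ∈ Icc (0 : ℝ) 1) (ht : t ∈ Icc (0 : ℝ) 1) :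
    φ (p - t) ≤ p * φ (1 - t) + (1 - p) * φ (-t) := by
  have := hφ.2 (show 1 - t ∈ Icc (-1 : ℝ) 1 from ⟨by linarith [ht.2], by linarith [ht.1]⟩)
    (show -t ∈ Icc (-1 : ℝ) 1 from ⟨by linarith [ht.2], by linarith [ht.1]⟩) hp.1
    (show 0 ≤ 1 - p by linarith [hp.2]) (by ring)
  simp only [smul_eq_mul] at this
  rwa [show p * (1 - t) + (1 - p) * -t = p - t by ring] at this

/-- Strictness is available only at `0`, where the chord over `[-t, 1 - t]` lies strictly above `φ 0
= 0`. As `p - t` lies between `0` and one endpoint, the chord from `0` to that endpoint bounds `φ (p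
- t)` and is itself strictly below the long chord there. -/
lemma sub_lt_two_point (hφ : ConvexOn ℝ (Icc (-1) 1) φ)
    (hs : StrictConvexOnAt (Icc (-1) 1) φ 0) (h0 : φ 0 = 0) {p t : ℝ}
    (hp : p ∈ Ioo (0 : ℝ) 1) (ht : t ∈ Ioo (0 : ℝ) 1) :
    φ (p - t) < p * φ (1 - t) + (1 - p) * φ (-t) := by
  have hpos := hs.two_point_pos h0 ht
  have ht0 := ht.1
  have ht1 : 0 < 1 - t := by linarith [ht.2]
  have hp0 := hp.1
  have hp1 : 0 < 1 - p := by linarith [hp.2]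
  have hz : (0 : ℝ) ∈ Icc (-1 : ℝ) 1 := by norm_num
  rcases le_total t p with h | h
  · have := hφ.2 (show 1 - t ∈ Icc (-1 : ℝ) 1 from ⟨by linarith, by linarith⟩) hz
      (show 0 ≤ (p - t) / (1 - t) from div_nonneg (by linarith) ht1.le)
      (show 0 ≤ (1 - p) / (1 - t) by positivity) (by field_simp; ring)
    simp only [smul_eq_mul, h0, mul_zero, add_zero] at this
    rw [div_mul_cancel₀ _ ht1.ne', div_mul_eq_mul_div, le_div_iff₀ ht1] at this
    nlinarith [mul_pos hp1 hpos]
  · have := hφ.2 (show -t ∈ Icc (-1 : ℝ) 1 from ⟨by linarith, by linarith⟩) hz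
      (show 0 ≤ (t - p) / t from div_nonneg (by linarith) ht0.le)
      (show 0 ≤ p / t by positivity) (by field_simp; ring)
    simp only [smul_eq_mul, h0, mul_zero, add_zero] at this
    rw [show (t - p) / t * -t = p - t by field_simp; ring, div_mul_eq_mul_div,
      le_div_iff₀ ht0] at this
    nlinarith [mul_pos hp0 hpos]

lemma convexOn_mul_le (hφ : ConvexOn ℝ (Icc (-1) 1) φ) (h0 : φ 0 = 0) {q e : ℝ}
    (hq : q ∈ Icc (0 : ℝ) 1) (he : e ∈ Icc (-1 : ℝ) 1) : φ (q * e) ≤ q * φ e := by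
  have := hφ.2 he (show (0 : ℝ) ∈ Icc (-1 : ℝ) 1 by norm_num) hq.1
    (show 0 ≤ 1 - q by linarith [hq.2]) (by ring)
  simpa [h0] using this

lemma two_point_le_four_point (hφ : ConvexOn ℝ (Icc (-1) 1) φ) (h0 : φ 0 = 0) {p q : ℝ}
    (hp : p ∈ Icc (0 : ℝ) 1) (hq : q ∈ Icc (0 : ℝ) 1) :
    p * φ (1 - q) + (1 - p) * φ (-q) ≤ p * (1 - q) * φ 1 + (1 - p) * q * φ (-1) := by
  have h1 := convexOn_mul_le hφ h0 (q := 1 - q) (e := 1)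
    ⟨by linarith [hq.2], by linarith [hq.1]⟩ (by norm_num)
  have h2 := convexOn_mul_le hφ h0 (q := q) (e := -1) hq (by norm_num)
  rw [mul_one] at h1
  rw [mul_neg, mul_one] at h2
  have h3 := mul_le_mul_of_nonneg_left h1 hp.1
  have h4 := mul_le_mul_of_nonneg_left h2 (show 0 ≤ 1 - p by linarith [hp.2])
  linarith

end Inequalities

/-! ### Sharp bounds for expectations of convex functions, with equality cases -/

section Expectations

lemma integral_eq_iff_ae_eq_of_le {Ω : Type*} [MeasurableSpace Ω] {P : Measure Ω} {f g : Ω → ℝ} (hf : Integrable f P) (hg : Integrable g P)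
    (h : ∀ ω, f ω ≤ g ω) : ∫ ω, f ω ∂P = ∫ ω, g ω ∂P ↔ f =ᵐ[P] g :=
  integral_eq_iff_of_ae_le hf hg (Eventually.of_forall h)

variable {φ : ℝ → ℝ} {Ω : Type*} [MeasurableSpace Ω] {P : Measure Ω} [IsProbabilityMeasure P]

lemma integrable_of_mem_Icc {U : Ω → ℝ} (hU : Measurable U) {a b : ℝ} (h : ∀ ω, U ω ∈ Icc a b) :
    Integrable U P :=
  Integrable.of_mem_Icc a b hU.aemeasurable (Eventually.of_forall h)

lemma integral_mem_unitInterval {S : Ω → ℝ} (hS1 : ∀ ω, S ω ∈ Icc (0 : ℝ) 1)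
    (hS : Measurable S) : ∫ ω, S ω ∂P ∈ Icc (0 : ℝ) 1 := by
  refine ⟨integral_nonneg fun ω => (hS1 ω).1, ?_⟩
  calc ∫ ω, S ω ∂P ≤ ∫ _, (1 : ℝ) ∂P :=
        integral_mono (integrable_of_mem_Icc hS hS1) (integrable_const _) fun ω => (hS1 ω).2
    _ = 1 := by simp

lemma sub_mem_Icc {s t : ℝ} (hs : s ∈ Icc (0 : ℝ) 1) (ht : t ∈ Icc (0 : ℝ) 1) :
    s - t ∈ Icc (-1 : ℝ) 1 :=
  ⟨by linarith [hs.1, ht.2], by linarith [hs.2, ht.1]⟩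

/-- Jensen's inequality at a centred variable, with its equality case, for `φ` strictly convex at
the single point `0`. -/
lemma integral_convex_centered (hφ : ConvexOn ℝ (Icc (-1) 1) φ)
    (hs : StrictConvexOnAt (Icc (-1) 1) φ 0) (h0 : φ 0 = 0) {U : Ω → ℝ} (hU : Measurable U)
    (hU1 : ∀ ω, U ω ∈ Icc (-1 : ℝ) 1) (hmean : ∫ ω, U ω ∂P = 0) :
    0 ≤ ∫ ω, φ (U ω) ∂P ∧ (∫ ω, φ (U ω) ∂P = 0 ↔ U =ᵐ[P] 0) := by
  obtain ⟨c, hc⟩ := exists_supporting_slope hφ (t := 0) (by rw [interior_Icc]; norm_num)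
  simp only [h0, zero_add, sub_zero] at hc
  have hUi : Integrable U P := integrable_of_mem_Icc hU hU1
  have hφi : Integrable (fun ω => φ (U ω)) P := integrable_convexOn_comp hφ hU hU1
  have hcz : ∫ ω, c * U ω ∂P = 0 := by rw [integral_const_mul, hmean, mul_zero]
  have hmono : ∫ ω, c * U ω ∂P ≤ ∫ ω, φ (U ω) ∂P :=
    integral_mono (hUi.const_mul c) hφi fun ω => hc _ (hU1 ω)
  refine ⟨by linarith, fun h => ?_, fun h => ?_⟩
  · have hae := (integral_eq_iff_ae_eq_of_le (hUi.const_mul c) hφi fun ω => hc _ (hU1 ω)).1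
      (hcz.trans h.symm)
    -- Equality puts `U` on the contact set of `φ` with a supporting line at `0`. Contact on both
    -- sides of `0` would contradict strict convexity there, so `U` has a constant sign and, being
    -- centred, vanishes.
    have hside : (∀ᵐ ω ∂P, 0 ≤ U ω) ∨ (∀ᵐ ω ∂P, U ω ≤ 0) := by
      by_cases hneg : ∃ x ∈ Icc (-1 : ℝ) 1, x < 0 ∧ φ x = c * x
      · obtain ⟨x, hx, hx0, hxe⟩ := hneg
        right
        filter_upwards [hae] with ω hω
        by_contra! hpos
        have := hs x hx (U ω) (hU1 ω) (by linarith) (U ω / (U ω - x)) (-x / (U ω - x))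
          (div_pos hpos (by linarith)) (div_pos (by linarith) (by linarith))
          (by rw [← add_div, div_eq_one_iff_eq (by linarith)]; ring)
          (by ring)
        rw [h0, ← hω, hxe] at this
        ring_nf at this
        exact lt_irrefl _ this
      · left
        filter_upwards [hae] with ω hω
        by_contra! hlt
        exact hneg ⟨U ω, hU1 ω, hlt, hω.symm⟩
    rcases hside with h' | h'
    · exact (integral_eq_zero_iff_of_nonneg_ae h' hUi).1 hmean
    · have : (fun ω => -U ω) =ᵐ[P] 0 :=
        (integral_eq_zero_iff_of_nonneg_ae (by filter_upwards [h'] with ω hω; simpa using hω)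
          hUi.neg).1 ((integral_neg U).trans (by rw [hmean, neg_zero]))
      filter_upwards [this] with ω hω
      simpa using hω
  · rw [integral_congr_ae (g := fun _ => (0 : ℝ)) (by filter_upwards [h] with ω hω; simp [hω, h0])]
    simp

variable {S : Ω → ℝ}

lemma integral_convex_sub_mean (hφ : ConvexOn ℝ (Icc (-1) 1) φ)
    (hs : StrictConvexOnAt (Icc (-1) 1) φ 0) (h0 : φ 0 = 0)
    (hS : Measurable S) (hS1 : ∀ ω, S ω ∈ Icc (0 : ℝ) 1) {m : ℝ} (hm : ∫ ω, S ω ∂P = m) :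
    0 ≤ ∫ ω, φ (S ω - m) ∂P ∧ (∫ ω, φ (S ω - m) ∂P = 0 ↔ S =ᵐ[P] fun _ => m) := by
  have hm1 : m ∈ Icc (0 : ℝ) 1 := hm ▸ integral_mem_unitInterval hS1 hS
  have hSi : Integrable S P := integrable_of_mem_Icc hS hS1
  have := integral_convex_centered (P := P) hφ hs h0 (U := fun ω => S ω - m) (hS.sub_const m)
    (fun ω => sub_mem_Icc (hS1 ω) hm1)
    (by rw [integral_sub hSi (integrable_const _), hm]; simp)
  refine ⟨this.1, this.2.trans ⟨fun h => ?_, fun h => ?_⟩⟩ <;>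
  · filter_upwards [h] with ω hω
    simp only [Pi.zero_apply] at *
    linarith

lemma integral_fst_sub_snd (hS : Integrable S P) :
    ∫ z : Ω × Ω, (S z.1 - S z.2) ∂(P.prod P) = 0 := by
  rw [integral_sub (hS.comp_fst P) (hS.comp_snd P), integral_fun_fst, integral_fun_snd]
  simp

/-- The difference of two independent copies is centred. If it vanishes a.s., integrating out the
second copy leaves `S = m`. -/
lemma integral_convex_sub_copy (hφ : ConvexOn ℝ (Icc (-1) 1) φ)
    (hs : StrictConvexOnAt (Icc (-1) 1) φ 0) (h0 : φ 0 = 0)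
    (hS : Measurable S) (hS1 : ∀ ω, S ω ∈ Icc (0 : ℝ) 1) {m : ℝ} (hm : ∫ ω, S ω ∂P = m) :
    0 ≤ ∫ z : Ω × Ω, φ (S z.1 - S z.2) ∂(P.prod P) ∧
      (∫ z : Ω × Ω, φ (S z.1 - S z.2) ∂(P.prod P) = 0 ↔ S =ᵐ[P] fun _ => m) := by
  have hSi : Integrable S P := integrable_of_mem_Icc hS hS1
  have := integral_convex_centered (P := P.prod P) hφ hs h0 (U := fun z => S z.1 - S z.2)
    (by fun_prop) (fun z => sub_mem_Icc (hS1 z.1) (hS1 z.2)) (integral_fst_sub_snd hSi)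
  refine ⟨this.1, this.2.trans ⟨fun h => ?_, fun h => ?_⟩⟩
  · have h2 := Measure.ae_ae_of_ae_prod h
    filter_upwards [h2] with ω hω
    have : ∫ ω', S ω' ∂P = ∫ _, S ω ∂P := integral_congr_ae (by
      filter_upwards [hω] with ω' h'
      simp only [Pi.zero_apply] at h'
      linarith)
    rw [← hm, this]
    simp
  · have h1 := Measure.quasiMeasurePreserving_fst (μ := P) (ν := P) |>.ae h
    have h2 := Measure.quasiMeasurePreserving_snd (μ := P) (ν := P) |>.ae h
    filter_upwards [h1, h2] with z hz1 hz2
    simp [hz1, hz2]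

/-- Integrate the chord inequality over `[-m, 1 - m]`: the chord is affine in `S`, so its integral
depends on the mean only. -/
lemma integral_convex_sub_mean_le (hφ : ConvexOn ℝ (Icc (-1) 1) φ)
    (hs : StrictConvexOnAt (Icc (-1) 1) φ 0) (h0 : φ 0 = 0)
    (hS : Measurable S) (hS1 : ∀ ω, S ω ∈ Icc (0 : ℝ) 1) {m : ℝ} (hm : ∫ ω, S ω ∂P = m) :
    ∫ ω, φ (S ω - m) ∂P ≤ m * φ (1 - m) + (1 - m) * φ (-m) ∧
      (∫ ω, φ (S ω - m) ∂P = m * φ (1 - m) + (1 - m) * φ (-m) ↔ ∀ᵐ ω ∂P, S ω = 0 ∨ S ω = 1) := by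
  have hm1 : m ∈ Icc (0 : ℝ) 1 := hm ▸ integral_mem_unitInterval hS1 hS
  have hSi : Integrable S P := integrable_of_mem_Icc hS hS1
  have hφi : Integrable (fun ω => φ (S ω - m)) P :=
    integrable_convexOn_comp hφ (hS.sub_const m) fun ω => sub_mem_Icc (hS1 ω) hm1
  have hSi' : Integrable (fun ω => 1 - S ω) P := (integrable_const _).sub hSi
  have hgi : Integrable (fun ω => S ω * φ (1 - m) + (1 - S ω) * φ (-m)) P :=
    (hSi.mul_const _).add (hSi'.mul_const _)
  have hg : ∫ ω, (S ω * φ (1 - m) + (1 - S ω) * φ (-m)) ∂P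
      = m * φ (1 - m) + (1 - m) * φ (-m) := by
    rw [integral_add (hSi.mul_const _) (hSi'.mul_const _),
      integral_mul_const, integral_mul_const, integral_sub (integrable_const _) hSi, hm]
    simp
  have hle : ∀ ω, φ (S ω - m) ≤ S ω * φ (1 - m) + (1 - S ω) * φ (-m) := fun ω =>
    convexOn_sub_le_two_point hφ (hS1 ω) hm1
  rw [← hg]
  refine ⟨integral_mono hφi hgi hle, (integral_eq_iff_ae_eq_of_le hφi hgi hle).trans
    ⟨fun h => ?_, fun h => ?_⟩⟩
  -- For `m = 0` or `m = 1` the chord inequality need not be strict, but the mean already forces `S`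
  -- to be constant.
  · rcases hm1.1.eq_or_lt with hm0 | hm0
    · have : S =ᵐ[P] 0 := (integral_eq_zero_iff_of_nonneg (fun ω => (hS1 ω).1) hSi).1
        (hm.trans hm0.symm)
      filter_upwards [this] with ω hω using Or.inl hω
    rcases hm1.2.eq_or_lt with hm2 | hm2
    · have : S =ᵐ[P] fun _ => 1 :=
        (integral_eq_iff_ae_eq_of_le hSi (integrable_const _) fun ω => (hS1 ω).2).1 (by simp [hm, hm2])
      filter_upwards [this] with ω hω using Or.inr hω
    filter_upwards [h] with ω hω
    by_contra! hne
    exact (sub_lt_two_point hφ hs h0 ⟨lt_of_le_of_ne (hS1 ω).1 (Ne.symm hne.1),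
      lt_of_le_of_ne (hS1 ω).2 hne.2⟩ ⟨hm0, hm2⟩).ne hω
  · filter_upwards [h] with ω hω
    rcases hω with h | h <;> simp [h]

/-- The bound is the value obtained by replacing the two copies of `S` by conditionally independent
Bernoulli variables with these success probabilities; their difference is `1`, `-1` or `0`, and `φ 0
= 0`. -/
lemma integral_convex_sub_copy_le (hφ : ConvexOn ℝ (Icc (-1) 1) φ)
    (hs : StrictConvexOnAt (Icc (-1) 1) φ 0) (h0 : φ 0 = 0)
    (hS : Measurable S) (hS1 : ∀ ω, S ω ∈ Icc (0 : ℝ) 1) {m : ℝ} (hm : ∫ ω, S ω ∂P = m) :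
    ∫ z : Ω × Ω, φ (S z.1 - S z.2) ∂(P.prod P) ≤ m * (1 - m) * (φ 1 + φ (-1)) ∧
      (∫ z : Ω × Ω, φ (S z.1 - S z.2) ∂(P.prod P) = m * (1 - m) * (φ 1 + φ (-1)) ↔
        ∀ᵐ ω ∂P, S ω = 0 ∨ S ω = 1) := by
  have hSi : Integrable S P := integrable_of_mem_Icc hS hS1
  have hSi' : Integrable (fun ω => 1 - S ω) P := (integrable_const _).sub hSi
  have hφi : Integrable (fun z : Ω × Ω => φ (S z.1 - S z.2)) (P.prod P) :=
    integrable_convexOn_comp hφ (by fun_prop) fun z => sub_mem_Icc (hS1 z.1) (hS1 z.2)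
  have hi1 : Integrable (fun z : Ω × Ω => S z.1 * (1 - S z.2) * φ 1) (P.prod P) :=
    (hSi.mul_prod hSi').mul_const _
  have hi2 : Integrable (fun z : Ω × Ω => (1 - S z.1) * S z.2 * φ (-1)) (P.prod P) :=
    (hSi'.mul_prod hSi).mul_const _
  have hg : ∫ z : Ω × Ω, (S z.1 * (1 - S z.2) * φ 1 + (1 - S z.1) * S z.2 * φ (-1)) ∂(P.prod P)
      = m * (1 - m) * (φ 1 + φ (-1)) := by
    rw [integral_add hi1 hi2, integral_mul_const, integral_mul_const,
      integral_prod_mul (f := S) (g := fun ω => 1 - S ω),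
      integral_prod_mul (f := fun ω => 1 - S ω) (g := S), integral_sub (integrable_const _) hSi, hm]
    simp
    ring
  have hle : ∀ z : Ω × Ω, φ (S z.1 - S z.2) ≤
      S z.1 * (1 - S z.2) * φ 1 + (1 - S z.1) * S z.2 * φ (-1) := fun z =>
    (convexOn_sub_le_two_point hφ (hS1 z.1) (hS1 z.2)).trans
      (two_point_le_four_point hφ h0 (hS1 z.1) (hS1 z.2))
  rw [← hg]
  refine ⟨integral_mono hφi (hi1.add hi2) hle,
    (integral_eq_iff_ae_eq_of_le hφi (hi1.add hi2) hle).trans ⟨fun h => ?_, fun h => ?_⟩⟩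
  · have hA : MeasurableSet (S ⁻¹' Ioo 0 1) := hS measurableSet_Ioo
    -- Strictness requires both copies to lie in `(0, 1)`. This product event is null, hence so is
    -- its factor.
    have hAA : (P.prod P) ((S ⁻¹' Ioo 0 1) ×ˢ (S ⁻¹' Ioo 0 1)) = 0 := by
      refine measure_mono_null (fun z hz => ?_) (ae_iff.1 h)
      exact fun hne => ((sub_lt_two_point hφ hs h0 hz.1 hz.2).trans_le
        (two_point_le_four_point hφ h0 (hS1 z.1) (hS1 z.2))).ne hne
    rw [Measure.prod_prod, mul_self_eq_zero] at hAA
    have : ∀ᵐ ω ∂P, ω ∉ S ⁻¹' Ioo 0 1 := measure_eq_zero_iff_ae_notMem.1 hAA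
    filter_upwards [this] with ω hω
    by_contra! hne
    exact hω ⟨lt_of_le_of_ne (hS1 ω).1 (Ne.symm hne.1), lt_of_le_of_ne (hS1 ω).2 hne.2⟩
  · have h1 := Measure.quasiMeasurePreserving_fst (μ := P) (ν := P) |>.ae h
    have h2 := Measure.quasiMeasurePreserving_snd (μ := P) (ν := P) |>.ae h
    filter_upwards [h1, h2] with z hz1 hz2
    rcases hz1 with h | h <;> rcases hz2 with h' | h' <;> simp [h, h', h0]

end Expectations

/-! ### Convex order: independent copies, conditional expectations, strictness -/

section ConvexOrder

variable {Ω : Type*} [MeasurableSpace Ω] {P : Measure Ω} [IsProbabilityMeasure P]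
  {Ω' : Type*} [MeasurableSpace Ω'] {P' : Measure Ω'} [IsProbabilityMeasure P']

lemma convexOn_univ_sub_right {ψ : ℝ → ℝ} (hψ : ConvexOn ℝ univ ψ) (t : ℝ) :
    ConvexOn ℝ univ fun s => ψ (s - t) := by
  refine ⟨convex_univ, fun x _ y _ a b ha hb hab => ?_⟩
  have := hψ.2 (mem_univ (x - t)) (mem_univ (y - t)) ha hb hab
  simp only [smul_eq_mul] at *
  rwa [show a * (x - t) + b * (y - t) = a * x + b * y - (a + b) * t by ring, hab, one_mul] at this

lemma convexOn_univ_sub_left {ψ : ℝ → ℝ} (hψ : ConvexOn ℝ univ ψ) (t : ℝ) :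
    ConvexOn ℝ univ fun s => ψ (t - s) := by
  refine ⟨convex_univ, fun x _ y _ a b ha hb hab => ?_⟩
  have := hψ.2 (mem_univ (t - x)) (mem_univ (t - y)) ha hb hab
  simp only [smul_eq_mul] at *
  rwa [show a * (t - x) + b * (t - y) = (a + b) * t - (a * x + b * y) by ring, hab, one_mul] at this

lemma continuous_of_convexOn_univ {ψ : ℝ → ℝ} (hψ : ConvexOn ℝ univ ψ) : Continuous ψ :=
  hψ.locallyLipschitz.continuous

lemma integrable_continuous_comp {ψ : ℝ → ℝ} (hψ : Continuous ψ) {U : Ω → ℝ} (hU : Measurable U)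
    {a b : ℝ} (h : ∀ ω, U ω ∈ Icc a b) : Integrable (fun ω => ψ (U ω)) P := by
  obtain ⟨C, hC⟩ := isCompact_Icc.exists_bound_of_continuousOn (s := Icc a b) hψ.continuousOn
  exact Integrable.of_bound (hψ.measurable.comp hU).aestronglyMeasurable C
    (Eventually.of_forall fun ω => hC _ (h ω))

lemma ConvexOrder.comp_sub_const {Ω : Type*} [MeasurableSpace Ω] {P : Measure Ω}
    {Ω' : Type*} [MeasurableSpace Ω'] {P' : Measure Ω'} {S : Ω → ℝ} {T : Ω' → ℝ} (h : ConvexOrder P S P' T) (t : ℝ) :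
    ConvexOrder P (fun ω => S ω - t) P' (fun ω => T ω - t) :=
  fun _ hψ => h _ (convexOn_univ_sub_right hψ t)

/-- Replace one coordinate at a time: for fixed other coordinate, `ψ (s - ·)` and `ψ (· - t)` are
convex. -/
lemma ConvexOrder.sub_copy {S : Ω → ℝ} {T : Ω' → ℝ} (h : ConvexOrder P S P' T)
    (hS : Measurable S) (hS1 : ∀ ω, S ω ∈ Icc (0 : ℝ) 1)
    (hT : Measurable T) (hT1 : ∀ ω, T ω ∈ Icc (0 : ℝ) 1) :
    ConvexOrder (P.prod P) (fun z => S z.1 - S z.2) (P'.prod P') (fun z => T z.1 - T z.2) := by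
  intro ψ hψ
  have hc := continuous_of_convexOn_univ hψ
  have i1 : Integrable (fun z : Ω × Ω => ψ (S z.1 - S z.2)) (P.prod P) :=
    integrable_continuous_comp hc (by fun_prop) fun z => sub_mem_Icc (hS1 z.1) (hS1 z.2)
  have i2 : Integrable (fun z : Ω × Ω' => ψ (S z.1 - T z.2)) (P.prod P') :=
    integrable_continuous_comp hc (by fun_prop) fun z => sub_mem_Icc (hS1 z.1) (hT1 z.2)
  have i3 : Integrable (fun z : Ω' × Ω' => ψ (T z.1 - T z.2)) (P'.prod P') :=
    integrable_continuous_comp hc (by fun_prop) fun z => sub_mem_Icc (hT1 z.1) (hT1 z.2)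
  calc ∫ z : Ω × Ω, ψ (S z.1 - S z.2) ∂(P.prod P)
      = ∫ x, ∫ y, ψ (S x - S y) ∂P ∂P := integral_prod _ i1
    _ ≤ ∫ x, ∫ y, ψ (S x - T y) ∂P' ∂P :=
        integral_mono i1.integral_prod_left i2.integral_prod_left
          fun x => h _ (convexOn_univ_sub_left hψ (S x))
    _ = ∫ y, ∫ x, ψ (S x - T y) ∂P ∂P' := integral_integral_swap i2
    _ ≤ ∫ y, ∫ x, ψ (T x - T y) ∂P' ∂P' :=
        integral_mono i2.integral_prod_right i3.integral_prod_right
          fun y => h _ (convexOn_univ_sub_right hψ (T y))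
    _ = ∫ z : Ω' × Ω', ψ (T z.1 - T z.2) ∂(P'.prod P') := (integral_prod_symm _ i3).symm

/-- The convex order tests convex functions that are defined on the range `[-1, 1]` only. -/
lemma ConvexOrder.integral_le {φ : ℝ → ℝ} (hφ : ConvexOn ℝ (Icc (-1) 1) φ) {U : Ω → ℝ} {V : Ω' → ℝ}
    (h : ConvexOrder P U P' V) (hU : Measurable U) (hU1 : ∀ ω, U ω ∈ Icc (-1 : ℝ) 1)
    (hV : Measurable V) (hV1 : ∀ ω, V ω ∈ Icc (-1 : ℝ) 1) :
    ∫ ω, φ (U ω) ∂P ≤ ∫ ω, φ (V ω) ∂P' := by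
  obtain ⟨g, C, hc, hb, hlim⟩ := exists_convexOn_univ_approx hφ
  have hg : ∀ n, Measurable (g n) := fun n => (continuous_of_convexOn_univ (hc n)).measurable
  have l1 : Tendsto (fun n => ∫ ω, g n (U ω) ∂P) atTop (𝓝 (∫ ω, φ (U ω) ∂P)) :=
    tendsto_integral_of_dominated_convergence (fun _ => C)
      (fun n => ((hg n).comp hU).aestronglyMeasurable) (integrable_const _)
      (fun n => Eventually.of_forall fun ω => hb n _ (hU1 ω))
      (Eventually.of_forall fun ω => hlim _ (hU1 ω))
  have l2 : Tendsto (fun n => ∫ ω, g n (V ω) ∂P') atTop (𝓝 (∫ ω, φ (V ω) ∂P')) :=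
    tendsto_integral_of_dominated_convergence (fun _ => C)
      (fun n => ((hg n).comp hV).aestronglyMeasurable) (integrable_const _)
      (fun n => Eventually.of_forall fun ω => hb n _ (hV1 ω))
      (Eventually.of_forall fun ω => hlim _ (hV1 ω))
  exact le_of_tendsto_of_tendsto' l1 l2 fun n => h _ (hc n)

/-- The integral at the midpoint is squeezed between that of `φ (U)` and the average of the two
equal integrals, so the pointwise midpoint inequality is an a.e. equality. -/
lemma ae_eq_of_integral_le_midpoint {φ : ℝ → ℝ} (hφ : StrictConvexOn ℝ (Icc (-1) 1) φ)
    {U V : Ω → ℝ} (hU : Measurable U) (hU1 : ∀ ω, U ω ∈ Icc (-1 : ℝ) 1)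
    (hV : Measurable V) (hV1 : ∀ ω, V ω ∈ Icc (-1 : ℝ) 1)
    (hmid : ∫ ω, φ (U ω) ∂P ≤ ∫ ω, φ ((U ω + V ω) / 2) ∂P)
    (heq : ∫ ω, φ (U ω) ∂P = ∫ ω, φ (V ω) ∂P) : U =ᵐ[P] V := by
  have hc := hφ.convexOn
  have iU : Integrable (fun ω => φ (U ω)) P := integrable_convexOn_comp hc hU hU1
  have iV : Integrable (fun ω => φ (V ω)) P := integrable_convexOn_comp hc hV hV1
  have iM : Integrable (fun ω => φ ((U ω + V ω) / 2)) P :=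
    integrable_convexOn_comp hc (by fun_prop) fun ω =>
      ⟨by linarith [(hU1 ω).1, (hV1 ω).1], by linarith [(hU1 ω).2, (hV1 ω).2]⟩
  have iA : Integrable (fun ω => (φ (U ω) + φ (V ω)) / 2) P := (iU.add iV).div_const 2
  have hle : ∀ ω, φ ((U ω + V ω) / 2) ≤ (φ (U ω) + φ (V ω)) / 2 := fun ω => by
    have := hc.2 (hU1 ω) (hV1 ω) (show (0 : ℝ) ≤ 1 / 2 by norm_num)
      (show (0 : ℝ) ≤ 1 / 2 by norm_num) (by norm_num)
    simp only [smul_eq_mul] at this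
    rw [show (U ω + V ω) / 2 = 1 / 2 * U ω + 1 / 2 * V ω by ring]
    linarith
  have hA : ∫ ω, (φ (U ω) + φ (V ω)) / 2 ∂P = ∫ ω, φ (U ω) ∂P := by
    rw [integral_div, integral_add iU iV, ← heq]
    ring
  have hae := (integral_eq_iff_ae_eq_of_le iM iA hle).1
    (le_antisymm (integral_mono iM iA hle) (hA.trans_le hmid))
  filter_upwards [hae] with ω hω
  by_contra hne
  have := hφ.2 (hU1 ω) (hV1 ω) hne (show (0 : ℝ) < 1 / 2 by norm_num)
    (show (0 : ℝ) < 1 / 2 by norm_num) (by norm_num)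
  simp only [smul_eq_mul] at this
  rw [show 1 / 2 * U ω + 1 / 2 * V ω = (U ω + V ω) / 2 by ring] at this
  linarith

/-- Conditional expectations decrease in the convex order. -/
lemma convexOrder_of_condExp {Ω : Type*} {m m0 : MeasurableSpace Ω} {P : Measure[m0] Ω}
    [IsProbabilityMeasure P] (hm : m ≤ m0) {S T : Ω → ℝ}
    (hT : Measurable[m0] T) {a b : ℝ} (hT1 : ∀ ω, T ω ∈ Icc a b) (hS : P[T|m] =ᵐ[P] S) :
    ConvexOrder P S P T := by
  intro ψ hψ
  have hc := continuous_of_convexOn_univ hψ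
  have iT : Integrable T P := integrable_of_mem_Icc hT hT1
  have iψ : Integrable (ψ ∘ T) P := integrable_continuous_comp hc hT hT1
  have hj := ConvexOn.map_condExp_le_univ hm hψ hc.lowerSemicontinuous iT iψ
  obtain ⟨C, hC⟩ := isCompact_Icc.exists_bound_of_continuousOn (s := Icc a b) hc.continuousOn
  have hmem : ∀ᵐ ω ∂P, P[T|m] ω ∈ Icc a b :=
    (convex_Icc a b).condExp_mem hm iT isClosed_Icc (Eventually.of_forall hT1)
  have iS : Integrable (fun ω => ψ (P[T|m] ω)) P :=
    Integrable.of_bound (hc.comp_aestronglyMeasurable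
      (stronglyMeasurable_condExp.mono hm).aestronglyMeasurable) C
      (by filter_upwards [hmem] with ω hω using hC _ hω)
  calc ∫ ω, ψ (S ω) ∂P = ∫ ω, ψ (P[T|m] ω) ∂P :=
        integral_congr_ae (by filter_upwards [hS] with ω hω; rw [hω])
    _ ≤ ∫ ω, P[ψ ∘ T|m] ω ∂P := integral_mono_ae iS integrable_condExp hj
    _ = ∫ ω, ψ (T ω) ∂P := integral_condExp hm

/-- `S` is also the conditional expectation of the midpoint, being a.e. its own conditional
expectation. This supplies the lower bound needed in the squeezing argument for strictly convex `φ`.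
-/
lemma convexOrder_midpoint_of_condExp {Ω : Type*} {m m0 : MeasurableSpace Ω} {P : Measure[m0] Ω}
    [IsProbabilityMeasure P] (hm : m ≤ m0) {S T : Ω → ℝ}
    (hSm : Measurable[m0] S) {a b : ℝ} (hS1 : ∀ ω, S ω ∈ Icc a b)
    (hT : Measurable[m0] T) (hT1 : ∀ ω, T ω ∈ Icc a b) (hS : P[T|m] =ᵐ[P] S) :
    ConvexOrder P S P (fun ω => (S ω + T ω) / 2) := by
  have iT : Integrable T P := integrable_of_mem_Icc hT hT1
  have iS : Integrable S P := integrable_of_mem_Icc hSm hS1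
  refine convexOrder_of_condExp hm (a := a) (b := b) (by fun_prop) (fun ω =>
      ⟨by linarith [(hT1 ω).1, (hS1 ω).1], by linarith [(hT1 ω).2, (hS1 ω).2]⟩) ?_
  have e1 : P[S|m] =ᵐ[P] S := by
    have h1 : P[S|m] =ᵐ[P] P[P[T|m]|m] := condExp_congr_ae hS.symm
    have h2 : P[P[T|m]|m] = P[T|m] :=
      condExp_of_stronglyMeasurable hm stronglyMeasurable_condExp integrable_condExp
    rw [h2] at h1
    exact h1.trans hS
  have e2 : (fun ω => (S ω + T ω) / 2) = (2⁻¹ : ℝ) • (S + T) := by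
    ext ω
    simp
    ring
  rw [e2]
  filter_upwards [condExp_smul (2⁻¹ : ℝ) (S + T) m (μ := P), condExp_add iS iT m, e1, hS]
    with ω h1 h2 h3 h4
  rw [h1, Pi.smul_apply, h2, Pi.add_apply, h3, h4]
  simp
  ring

section Strict

variable {φ : ℝ → ℝ} {S T : Ω → ℝ}

lemma ae_eq_of_integral_sub_const_eq (hφ : StrictConvexOn ℝ (Icc (-1) 1) φ)
    (hS : Measurable S) (hS1 : ∀ ω, S ω ∈ Icc (0 : ℝ) 1)
    (hT : Measurable T) (hT1 : ∀ ω, T ω ∈ Icc (0 : ℝ) 1)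
    (hmid : ConvexOrder P S P (fun ω => (S ω + T ω) / 2)) {t : ℝ} (ht : t ∈ Icc (0 : ℝ) 1)
    (heq : ∫ ω, φ (S ω - t) ∂P = ∫ ω, φ (T ω - t) ∂P) : S =ᵐ[P] T := by
  have hM1 : ∀ ω, (S ω + T ω) / 2 ∈ Icc (0 : ℝ) 1 := fun ω =>
    ⟨by linarith [(hT1 ω).1, (hS1 ω).1], by linarith [(hT1 ω).2, (hS1 ω).2]⟩
  have := ae_eq_of_integral_le_midpoint (P := P) hφ (U := fun ω => S ω - t)
    (V := fun ω => T ω - t) (by fun_prop)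
    (fun ω => sub_mem_Icc (hS1 ω) ht) (by fun_prop) (fun ω => sub_mem_Icc (hT1 ω) ht) ?_ heq
  · filter_upwards [this] with ω hω
    linarith
  · refine ((hmid.comp_sub_const t).integral_le hφ.convexOn (by fun_prop)
      (fun ω => sub_mem_Icc (hS1 ω) ht) (by fun_prop)
      (fun ω => sub_mem_Icc (hM1 ω) ht)).trans_eq ?_
    congr with ω
    congr 1
    ring

lemma ae_eq_of_integral_sub_copy_eq (hφ : StrictConvexOn ℝ (Icc (-1) 1) φ)
    (hS : Measurable S) (hS1 : ∀ ω, S ω ∈ Icc (0 : ℝ) 1)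
    (hT : Measurable T) (hT1 : ∀ ω, T ω ∈ Icc (0 : ℝ) 1)
    (hmid : ConvexOrder P S P (fun ω => (S ω + T ω) / 2)) (hmean : ∫ ω, S ω ∂P = ∫ ω, T ω ∂P)
    (heq : ∫ z : Ω × Ω, φ (S z.1 - S z.2) ∂(P.prod P)
      = ∫ z : Ω × Ω, φ (T z.1 - T z.2) ∂(P.prod P)) : S =ᵐ[P] T := by
  have hM1 : ∀ ω, (S ω + T ω) / 2 ∈ Icc (0 : ℝ) 1 := fun ω =>
    ⟨by linarith [(hT1 ω).1, (hS1 ω).1], by linarith [(hT1 ω).2, (hS1 ω).2]⟩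
  have := ae_eq_of_integral_le_midpoint (P := P.prod P) hφ (U := fun z => S z.1 - S z.2)
    (V := fun z => T z.1 - T z.2) (by fun_prop)
    (fun z => sub_mem_Icc (hS1 z.1) (hS1 z.2)) (by fun_prop)
    (fun z => sub_mem_Icc (hT1 z.1) (hT1 z.2)) ?_ heq
  · have iS : Integrable S P := integrable_of_mem_Icc hS hS1
    have iT : Integrable T P := integrable_of_mem_Icc hT hT1
    filter_upwards [Measure.ae_ae_of_ae_prod this] with ω hω
    -- Integrating out the second copy and using the equal means turns equality of differences into
    -- equality of variables.
    have h2 : ∫ ω', (S ω - S ω') ∂P = ∫ ω', (T ω - T ω') ∂P := integral_congr_ae hω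
    rw [integral_sub (integrable_const _) iS, integral_sub (integrable_const _) iT, hmean] at h2
    simpa using h2
  · refine ((hmid.sub_copy hS hS1 (by fun_prop) hM1).integral_le hφ.convexOn (by fun_prop)
      (fun z => sub_mem_Icc (hS1 z.1) (hS1 z.2)) (by fun_prop)
      (fun z => sub_mem_Icc (hM1 z.1) (hM1 z.2))).trans_eq ?_
    congr with z
    congr 1
    ring

end Strict

end ConvexOrder

/-! ### Conditional distribution functions and passage from almost all levels to all -/

section DistributionFunctions

variable {Ω : Type*} [MeasurableSpace Ω] {P : Measure Ω} [IsProbabilityMeasure P]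
  {E : Type*} [MeasurableSpace E] {Y : Ω → ℝ} {X : Ω → E}

lemma measureReal_mem_unitInterval {α : Type*} [MeasurableSpace α] (μ : Measure α)
    [IsProbabilityMeasure μ] (s : Set α) : μ.real s ∈ Icc (0 : ℝ) 1 :=
  ⟨measureReal_nonneg, measureReal_le_one⟩

lemma condDistFun_mem (x : E) (y : ℝ) : condDistFun P Y X x y ∈ Icc (0 : ℝ) 1 :=
  measureReal_mem_unitInterval _ _

lemma distFun_eq (hY : Measurable Y) (y : ℝ) : distFun P Y y = (P.map Y).real (Iic y) := by
  have := Measure.isProbabilityMeasure_map (μ := P) hY.aemeasurable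
  exact cdf_eq_real _ _

lemma distFun_mem {P : Measure Ω} (y : ℝ) : distFun P Y y ∈ Icc (0 : ℝ) 1 :=
  ⟨cdf_nonneg _ _, cdf_le_one _ _⟩

lemma monotone_distFun {P : Measure Ω} : Monotone (distFun P Y) := monotone_cdf _

lemma measurable_distFun {P : Measure Ω} : Measurable (distFun P Y) := monotone_distFun.measurable

lemma measurable_condDistFun : Measurable fun z : E × ℝ => condDistFun P Y X z.1 z.2 := by
  have h := Kernel.measurable_kernel_prodMk_left (κ := (condDistrib Y X P).prodMkRight ℝ)
    (t := {z : (E × ℝ) × ℝ | z.2 ≤ z.1.2}) (measurableSet_le (by fun_prop) (by fun_prop))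
  exact h.ennreal_toReal

lemma measurable_condDistFun_comp (hX : Measurable X) (y : ℝ) :
    Measurable fun ω => condDistFun P Y X (X ω) y :=
  measurable_condDistFun.comp (hX.prodMk measurable_const)

lemma measurable_condDistrib_comp (hX : Measurable X) {B : Set ℝ} (hB : MeasurableSet B) :
    Measurable fun ω => condDistrib Y X P (X ω) B :=
  ((condDistrib Y X P).measurable_coe hB).comp hX

lemma measurable_condDistrib_real_comp (hX : Measurable X) {B : Set ℝ} (hB : MeasurableSet B) :
    Measurable fun ω => (condDistrib Y X P (X ω)).real B :=
  (measurable_condDistrib_comp hX hB).ennreal_toReal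

lemma lintegral_condDistrib (hX : Measurable X) (hY : Measurable Y) {B : Set ℝ}
    (hB : MeasurableSet B) : ∫⁻ ω, condDistrib Y X P (X ω) B ∂P = P.map Y B := by
  have := setLIntegral_preimage_condDistrib (μ := P) hX hY.aemeasurable hB MeasurableSet.univ
  simpa [Measure.map_apply hY hB] using this

lemma integral_condDistrib_real (hX : Measurable X) (hY : Measurable Y) {B : Set ℝ}
    (hB : MeasurableSet B) : ∫ ω, (condDistrib Y X P (X ω)).real B ∂P = (P.map Y).real B := by
  simp only [measureReal_def]
  rw [integral_toReal (measurable_condDistrib_comp hX hB).aemeasurable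
    (Eventually.of_forall fun ω => measure_lt_top _ _), lintegral_condDistrib hX hY hB]

lemma integral_condDistFun (hX : Measurable X) (hY : Measurable Y) (y : ℝ) :
    ∫ ω, condDistFun P Y X (X ω) y ∂P = distFun P Y y :=
  (integral_condDistrib_real hX hY measurableSet_Iic).trans (distFun_eq hY y).symm

lemma condDistrib_eq_zero_of_map_eq_zero (hX : Measurable X) (hY : Measurable Y) {N : Set ℝ}
    (hN : MeasurableSet N) (h : P.map Y N = 0) : ∀ᵐ ω ∂P, condDistrib Y X P (X ω) N = 0 := by
  rw [← lintegral_condDistrib hX hY hN,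
    lintegral_eq_zero_iff (measurable_condDistrib_comp hX hN)] at h
  exact h

/-- Continuity from below, with a null set allowed to be missed; this slack covers gaps in the
support of the law of `Y`. -/
lemma tendsto_measureReal_of_monotone (μ : Measure ℝ) [IsProbabilityMeasure μ] {B : ℕ → Set ℝ}
    {V : Set ℝ} (hBm : Monotone B) (hBV : ∀ n, B n ⊆ V) (h : μ (V \ ⋃ n, B n) = 0) :
    Tendsto (fun n => μ.real (B n)) atTop (𝓝 (μ.real V)) := by
  have h1 : μ V = μ (⋃ n, B n) :=
    le_antisymm (by
      calc μ V ≤ μ ((⋃ n, B n) ∪ (V \ ⋃ n, B n)) := measure_mono (by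
            rw [union_sdiff_self]
            exact subset_union_right)
        _ ≤ _ := measure_union_le _ _
        _ = _ := by rw [h, add_zero]) (measure_mono (iUnion_subset hBV))
  rw [measureReal_def, h1]
  exact (ENNReal.tendsto_toReal (measure_ne_top _ _)).comp (tendsto_measure_iUnion_atTop hBm)

lemma ae_tendsto_condDistrib (hX : Measurable X) (hY : Measurable Y) {B : ℕ → Set ℝ}
    {V : Set ℝ} (hBm : Monotone B) (hB : ∀ n, MeasurableSet (B n)) (hV : MeasurableSet V)
    (hBV : ∀ n, B n ⊆ V) (h : P.map Y (V \ ⋃ n, B n) = 0) :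
    ∀ᵐ ω ∂P, Tendsto (fun n => (condDistrib Y X P (X ω)).real (B n)) atTop
      (𝓝 ((condDistrib Y X P (X ω)).real V)) := by
  filter_upwards [condDistrib_eq_zero_of_map_eq_zero hX hY
    (hV.diff (MeasurableSet.iUnion hB)) h] with ω hω
  exact tendsto_measureReal_of_monotone _ hBm hBV hω

/-- A property of real numbers that holds almost everywhere holds everywhere if it passes to limits
from below along which the distribution function converges. -/
lemma forall_of_ae_of_limit (μ : Measure ℝ) {Q : ℝ → Prop} (h : ∀ᵐ y ∂μ, Q y)
    (hzero : ∀ y, μ (Iic y) = 0 → Q y)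
    (hlim : ∀ (y : ℝ) (s : ℕ → ℝ), Monotone s → (∀ n, s n ≤ y) → (∀ n, Q (s n)) →
      μ (Iic y \ ⋃ n, Iic (s n)) = 0 → Q y) (y : ℝ) : Q y := by
  by_cases hy : μ (Iic y) = 0
  · exact hzero y hy
  let D : Set ℝ := {x | Q x ∧ x ≤ y}
  -- The good levels `D` below `y` carry all the mass of `Iic y`. So approaching `sSup D` through
  -- `D`, or staying there if it is attained, exhausts `Iic y` up to a null set.
  have hnull : ∀ A ⊆ Iic y, Disjoint A D → μ A = 0 := fun A hA hd =>
    measure_mono_null (fun x hx hQ => (disjoint_left.1 hd hx) ⟨hQ, hA hx⟩) (ae_iff.1 h)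
  have hne : D.Nonempty := by
    by_contra hD
    rw [not_nonempty_iff_eq_empty] at hD
    exact hy (hnull _ Subset.rfl (by rw [hD]; exact disjoint_empty _))
  have hbdd : BddAbove D := ⟨y, fun x hx => hx.2⟩
  by_cases hs : sSup D ∈ D
  · refine hlim y (fun _ => sSup D) monotone_const (fun _ => hs.2) (fun _ => hs.1) ?_
    refine hnull _ sdiff_subset (disjoint_left.2 fun x hx hxD => hx.2 ?_)
    exact mem_iUnion.2 ⟨0, le_csSup hbdd hxD⟩
  · obtain ⟨u, hu, hut, huD⟩ := exists_seq_tendsto_sSup hne hbdd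
    refine hlim y u hu (fun n => (huD n).2) (fun n => (huD n).1) ?_
    refine hnull _ sdiff_subset (disjoint_left.2 fun x hx hxD => hx.2 ?_)
    have hlt : x < sSup D := lt_of_le_of_ne (le_csSup hbdd hxD) fun h => hs (h ▸ hxD)
    obtain ⟨n, hn⟩ := (hut.eventually (lt_mem_nhds hlt)).exists
    exact mem_iUnion.2 ⟨n, hn.le⟩

lemma monotone_Iic_comp {s : ℕ → ℝ} (hs : Monotone s) : Monotone fun n => Iic (s n) :=
  fun _ _ h => Iic_subset_Iic.2 (hs h)

lemma ae_tendsto_condDistFun (hX : Measurable X) (hY : Measurable Y) {y : ℝ} {s : ℕ → ℝ}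
    (hs : Monotone s) (hle : ∀ n, s n ≤ y) (h : P.map Y (Iic y \ ⋃ n, Iic (s n)) = 0) :
    ∀ᵐ ω ∂P, Tendsto (fun n => condDistFun P Y X (X ω) (s n)) atTop
      (𝓝 (condDistFun P Y X (X ω) y)) :=
  ae_tendsto_condDistrib hX hY (monotone_Iic_comp hs) (fun _ => measurableSet_Iic)
    measurableSet_Iic (fun n => Iic_subset_Iic.2 (hle n)) h

lemma tendsto_distFun (hY : Measurable Y) {y : ℝ} {s : ℕ → ℝ}
    (hs : Monotone s) (hle : ∀ n, s n ≤ y) (h : P.map Y (Iic y \ ⋃ n, Iic (s n)) = 0) :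
    Tendsto (fun n => distFun P Y (s n)) atTop (𝓝 (distFun P Y y)) := by
  have := Measure.isProbabilityMeasure_map (μ := P) hY.aemeasurable
  simp only [distFun_eq hY]
  exact tendsto_measureReal_of_monotone _ (monotone_Iic_comp hs)
    (fun n => Iic_subset_Iic.2 (hle n)) h

lemma condDistFun_eq_zero (hX : Measurable X) (hY : Measurable Y) {y : ℝ}
    (h : P.map Y (Iic y) = 0) : ∀ᵐ ω ∂P, condDistFun P Y X (X ω) y = 0 := by
  filter_upwards [condDistrib_eq_zero_of_map_eq_zero (X := X) hX hY measurableSet_Iic h] with ω hω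
  simp [condDistFun, measureReal_def, hω]

lemma isProbabilityMeasure_ext_of_Iic_rat {m m' : Measure ℝ} [IsProbabilityMeasure m]
    [IsProbabilityMeasure m'] (h : ∀ q : ℚ, m.real (Iic (q : ℝ)) = m'.real (Iic (q : ℝ))) :
    m = m' := by
  refine ext_of_generate_finite _ ((BorelSpace.measurable_eq (α := ℝ)).trans
    Real.borel_eq_generateFrom_Iic_rat) Real.isPiSystem_Iic_rat ?_ (by simp)
  intro s hs
  simp only [mem_iUnion, mem_singleton_iff] at hs
  obtain ⟨q, rfl⟩ := hs
  exact (measureReal_eq_measureReal_iff).1 (h q)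

lemma ae_eq_measure_of_ae_eq_Iic {P : Measure Ω} {m m' : Ω → Measure ℝ} [∀ ω, IsProbabilityMeasure (m ω)]
    [∀ ω, IsProbabilityMeasure (m' ω)]
    (h : ∀ y : ℝ, ∀ᵐ ω ∂P, (m ω).real (Iic y) = (m' ω).real (Iic y)) : ∀ᵐ ω ∂P, m ω = m' ω := by
  filter_upwards [ae_all_iff.2 fun q : ℚ => h q] with ω hω
  exact isProbabilityMeasure_ext_of_Iic_rat hω

end DistributionFunctions

/-! ### Functionals and normalizers as integrals over levels -/

section Formulas

variable {Ω : Type*} [MeasurableSpace Ω] {P : Measure Ω} [IsProbabilityMeasure P]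
  {E : Type*} [MeasurableSpace E] {Y : Ω → ℝ} {X : Ω → E} {φ : ℝ → ℝ}

lemma measurable_xi_integrand (hφ : ConvexOn ℝ (Icc (-1) 1) φ) :
    Measurable fun z : E × ℝ => φ (condDistFun P Y X z.1 z.2 - distFun P Y z.2) :=
  measurable_convexOn_comp hφ (measurable_condDistFun.sub (measurable_distFun.comp measurable_snd))
    fun _ => sub_mem_Icc (condDistFun_mem _ _) (distFun_mem _)

lemma measurable_lambda_integrand (hφ : ConvexOn ℝ (Icc (-1) 1) φ) :
    Measurable fun z : (E × E) × ℝ =>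
      φ (condDistFun P Y X z.1.1 z.2 - condDistFun P Y X z.1.2 z.2) :=
  measurable_convexOn_comp hφ ((measurable_condDistFun.comp (by fun_prop :
      Measurable fun z : (E × E) × ℝ => (z.1.1, z.2))).sub
    (measurable_condDistFun.comp (by fun_prop : Measurable fun z : (E × E) × ℝ => (z.1.2, z.2))))
    fun z => sub_mem_Icc (condDistFun_mem _ _) (condDistFun_mem _ _)

/-- The contribution of level `y` to the numerator of `ξ_φ`. -/
def xiAt (φ : ℝ → ℝ) (P : Measure Ω) [IsFiniteMeasure P] (Y : Ω → ℝ) (X : Ω → E) (y : ℝ) : ℝ :=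
  ∫ ω, φ (condDistFun P Y X (X ω) y - distFun P Y y) ∂P

/-- The contribution of level `y` to the numerator of `Λ_φ`. -/
def lambdaAt (φ : ℝ → ℝ) (P : Measure Ω) [IsFiniteMeasure P] (Y : Ω → ℝ) (X : Ω → E) (y : ℝ) : ℝ :=
  ∫ z : Ω × Ω, φ (condDistFun P Y X (X z.1) y - condDistFun P Y X (X z.2) y) ∂(P.prod P)

/-- The integrand of `α_φ` at a level with distribution function value `u`. -/
def alphaAt (φ : ℝ → ℝ) (u : ℝ) : ℝ := u * φ (1 - u) + (1 - u) * φ (-u)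

/-- The integrand of `β_φ` at a level with distribution function value `u`. -/
def betaAt (φ : ℝ → ℝ) (u : ℝ) : ℝ := u * (1 - u) * (φ 1 + φ (-1))

lemma xiPhi_eq (hφ : ConvexOn ℝ (Icc (-1) 1) φ) (hX : Measurable X) (hY : Measurable Y) :
    xiPhi φ P Y X = (alphaPhi φ P Y)⁻¹ * ∫ y, xiAt φ P Y X y ∂(P.map Y) := by
  have := Measure.isProbabilityMeasure_map (μ := P) hY.aemeasurable
  have := Measure.isProbabilityMeasure_map (μ := P) hX.aemeasurable
  unfold xiPhi xiAt
  congr 1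
  rw [integral_integral_swap]
  · congr with y
    exact integral_map hX.aemeasurable (((measurable_xi_integrand hφ).comp
      (by fun_prop : Measurable fun x : E => (x, y))).aestronglyMeasurable)
  · obtain ⟨C, -, hC⟩ := exists_abs_le_of_convexOn hφ
    exact Integrable.of_bound (measurable_xi_integrand hφ).aestronglyMeasurable C
      (Eventually.of_forall fun z => hC _ (sub_mem_Icc (condDistFun_mem _ _) (distFun_mem _)))

lemma lambdaPhi_eq (hφ : ConvexOn ℝ (Icc (-1) 1) φ) (hX : Measurable X) (hY : Measurable Y) :
    lambdaPhi φ P Y X = (betaPhi φ P Y)⁻¹ * ∫ y, lambdaAt φ P Y X y ∂(P.map Y) := by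
  have := Measure.isProbabilityMeasure_map (μ := P) hY.aemeasurable
  have := Measure.isProbabilityMeasure_map (μ := P) hX.aemeasurable
  unfold lambdaPhi lambdaAt
  congr 1
  rw [integral_integral_swap]
  · congr with y
    rw [Measure.map_prod_map _ _ hX hX]
    exact integral_map (hX.prodMap hX).aemeasurable (((measurable_lambda_integrand hφ).comp
      (by fun_prop : Measurable fun x : E × E => (x, y))).aestronglyMeasurable)
  · obtain ⟨C, -, hC⟩ := exists_abs_le_of_convexOn hφ
    exact Integrable.of_bound (measurable_lambda_integrand hφ).aestronglyMeasurable C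
      (Eventually.of_forall fun z => hC _ (sub_mem_Icc (condDistFun_mem _ _) (condDistFun_mem _ _)))

lemma indicator_one_mem {α : Type*} (s : Set α) (x : α) :
    s.indicator (fun _ => (1 : ℝ)) x ∈ Icc (0 : ℝ) 1 := by
  by_cases h : x ∈ s <;> simp [h]

lemma indicator_one_eq_or {α : Type*} (s : Set α) (x : α) :
    s.indicator (fun _ => (1 : ℝ)) x = 0 ∨ s.indicator (fun _ => (1 : ℝ)) x = 1 := by
  by_cases h : x ∈ s <;> simp [h]

lemma measurable_indicator_Iic :
    Measurable fun z : ℝ × ℝ => (Iic z.2).indicator (fun _ => (1 : ℝ)) z.1 := by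
  have : (fun z : ℝ × ℝ => (Iic z.2).indicator (fun _ => (1 : ℝ)) z.1)
      = {z : ℝ × ℝ | z.1 ≤ z.2}.indicator fun _ => (1 : ℝ) := by
    ext z
    by_cases h : z.1 ≤ z.2 <;> simp [h]
  rw [this]
  exact measurable_const.indicator (measurableSet_le measurable_fst measurable_snd)

lemma integral_indicator_Iic (hY : Measurable Y) (y : ℝ) :
    ∫ t, (Iic y).indicator (fun _ => (1 : ℝ)) t ∂(P.map Y) = distFun P Y y := by
  rw [integral_indicator_const _ measurableSet_Iic, distFun_eq hY]
  simp

lemma alphaPhi_eq (hφ : ConvexOn ℝ (Icc (-1) 1) φ) (hs : StrictConvexOnAt (Icc (-1) 1) φ 0)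
    (h0 : φ 0 = 0) (hY : Measurable Y) :
    alphaPhi φ P Y = ∫ y, alphaAt φ (distFun P Y y) ∂(P.map Y) := by
  have := Measure.isProbabilityMeasure_map (μ := P) hY.aemeasurable
  unfold alphaPhi alphaAt
  rw [integral_integral_swap]
  · congr with y
    -- An indicator takes only the values `0` and `1`, so the equality case of the upper bound
    -- evaluates the inner integral.
    exact (integral_convex_sub_mean_le hφ hs h0 (measurable_const.indicator measurableSet_Iic)
      (fun t => indicator_one_mem (Iic y) t) (integral_indicator_Iic hY y)).2.2
      (Eventually.of_forall fun t => indicator_one_eq_or _ _)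
  · exact integrable_convexOn_comp hφ
      (measurable_indicator_Iic.sub (measurable_distFun.comp measurable_snd))
      fun z => sub_mem_Icc (indicator_one_mem _ _) (distFun_mem _)

lemma betaPhi_eq (hφ : ConvexOn ℝ (Icc (-1) 1) φ) (hs : StrictConvexOnAt (Icc (-1) 1) φ 0)
    (h0 : φ 0 = 0) (hY : Measurable Y) :
    betaPhi φ P Y = ∫ y, betaAt φ (distFun P Y y) ∂(P.map Y) := by
  have := Measure.isProbabilityMeasure_map (μ := P) hY.aemeasurable
  unfold betaPhi betaAt
  rw [integral_integral_swap]
  · congr with y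
    exact (integral_convex_sub_copy_le hφ hs h0 (measurable_const.indicator measurableSet_Iic)
      (fun t => indicator_one_mem (Iic y) t) (integral_indicator_Iic hY y)).2.2
      (Eventually.of_forall fun t => indicator_one_eq_or _ _)
  · exact integrable_convexOn_comp hφ
      ((measurable_indicator_Iic.comp (by fun_prop :
        Measurable fun z : (ℝ × ℝ) × ℝ => (z.1.1, z.2))).sub
      (measurable_indicator_Iic.comp (by fun_prop :
        Measurable fun z : (ℝ × ℝ) × ℝ => (z.1.2, z.2))))
      fun z => sub_mem_Icc (indicator_one_mem _ _) (indicator_one_mem _ _)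

lemma measurable_xiAt (hφ : ConvexOn ℝ (Icc (-1) 1) φ) (hX : Measurable X) :
    Measurable (xiAt φ P Y X) := by
  have : StronglyMeasurable fun z : ℝ × Ω =>
      φ (condDistFun P Y X (X z.2) z.1 - distFun P Y z.1) :=
    ((measurable_xi_integrand hφ).comp
      (by fun_prop : Measurable fun z : ℝ × Ω => (X z.2, z.1))).stronglyMeasurable
  exact (this.integral_prod_right' (ν := P)).measurable

lemma measurable_lambdaAt (hφ : ConvexOn ℝ (Icc (-1) 1) φ) (hX : Measurable X) :
    Measurable (lambdaAt φ P Y X) := by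
  have : StronglyMeasurable fun z : ℝ × (Ω × Ω) =>
      φ (condDistFun P Y X (X z.2.1) z.1 - condDistFun P Y X (X z.2.2) z.1) :=
    ((measurable_lambda_integrand hφ).comp
      (by fun_prop : Measurable fun z : ℝ × (Ω × Ω) => ((X z.2.1, X z.2.2), z.1))).stronglyMeasurable
  exact (this.integral_prod_right' (ν := P.prod P)).measurable

lemma abs_integral_convexOn_comp_le {α : Type*} [MeasurableSpace α] {μ : Measure α}
    [IsProbabilityMeasure μ] {C : ℝ} (hC : ∀ t ∈ Icc (-1 : ℝ) 1, |φ t| ≤ C) {U : α → ℝ}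
    (hU : ∀ x, U x ∈ Icc (-1 : ℝ) 1) : |∫ x, φ (U x) ∂μ| ≤ C := by
  have := norm_integral_le_of_norm_le_const (μ := μ) (f := fun x => φ (U x)) (C := C)
    (Eventually.of_forall fun x => hC _ (hU x))
  simpa using this

lemma integrable_xiAt (hφ : ConvexOn ℝ (Icc (-1) 1) φ) (hX : Measurable X) (μ : Measure ℝ)
    [IsFiniteMeasure μ] : Integrable (xiAt φ P Y X) μ := by
  obtain ⟨C, -, hC⟩ := exists_abs_le_of_convexOn hφ
  exact Integrable.of_bound (measurable_xiAt hφ hX).aestronglyMeasurable C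
    (Eventually.of_forall fun y => abs_integral_convexOn_comp_le hC
      fun ω => sub_mem_Icc (condDistFun_mem _ _) (distFun_mem _))

lemma integrable_lambdaAt (hφ : ConvexOn ℝ (Icc (-1) 1) φ) (hX : Measurable X) (μ : Measure ℝ)
    [IsFiniteMeasure μ] : Integrable (lambdaAt φ P Y X) μ := by
  obtain ⟨C, -, hC⟩ := exists_abs_le_of_convexOn hφ
  exact Integrable.of_bound (measurable_lambdaAt hφ hX).aestronglyMeasurable C
    (Eventually.of_forall fun y => abs_integral_convexOn_comp_le hC
      fun z => sub_mem_Icc (condDistFun_mem _ _) (condDistFun_mem _ _))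

lemma measurable_alphaAt_distFun {P : Measure Ω} (hφ : ConvexOn ℝ (Icc (-1) 1) φ) :
    Measurable fun y => alphaAt φ (distFun P Y y) := by
  have hF : Measurable (distFun P Y) := measurable_distFun
  have hz : (0 : ℝ) ∈ Icc (0 : ℝ) 1 := by norm_num
  have ho : (1 : ℝ) ∈ Icc (0 : ℝ) 1 := by norm_num
  have h1 : Measurable fun y => φ (1 - distFun P Y y) :=
    measurable_convexOn_comp hφ (by fun_prop) fun y => sub_mem_Icc ho (distFun_mem y)
  have h2 : Measurable fun y => φ (-distFun P Y y) :=
    measurable_convexOn_comp hφ (by fun_prop) fun y => by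
      simpa using sub_mem_Icc hz (distFun_mem (P := P) (Y := Y) y)
  exact (hF.mul h1).add ((measurable_const.sub hF).mul h2)

lemma integrable_alphaAt_distFun {P : Measure Ω} (hφ : ConvexOn ℝ (Icc (-1) 1) φ) (μ : Measure ℝ)
    [IsFiniteMeasure μ] : Integrable (fun y => alphaAt φ (distFun P Y y)) μ := by
  obtain ⟨C, hC0, hC⟩ := exists_abs_le_of_convexOn hφ
  refine Integrable.of_bound (measurable_alphaAt_distFun hφ).aestronglyMeasurable C
    (Eventually.of_forall fun y => ?_)
  obtain ⟨h0, h1⟩ := distFun_mem (P := P) (Y := Y) y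
  obtain ⟨a1, a2⟩ := abs_le.1 (hC (1 - distFun P Y y) ⟨by linarith, by linarith⟩)
  obtain ⟨b1, b2⟩ := abs_le.1 (hC (-distFun P Y y) ⟨by linarith, by linarith⟩)
  rw [Real.norm_eq_abs, abs_le]
  unfold alphaAt
  constructor <;> nlinarith

lemma measurable_betaAt_distFun {P : Measure Ω} :
    Measurable fun y => betaAt φ (distFun P Y y) := by
  have hF : Measurable (distFun P Y) := measurable_distFun
  exact (hF.mul (measurable_const.sub hF)).mul_const _

lemma integrable_betaAt_distFun {P : Measure Ω} (μ : Measure ℝ)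
    [IsFiniteMeasure μ] : Integrable (fun y => betaAt φ (distFun P Y y)) μ := by
  have hF : Measurable (distFun P Y) := measurable_distFun
  refine Integrable.mul_const (Integrable.of_mem_Icc 0 1 (by fun_prop) (Eventually.of_forall fun y => ?_)) _
  obtain ⟨h0, h1⟩ := distFun_mem (P := P) (Y := Y) y
  constructor <;> nlinarith

end Formulas

/-! ### Independence, functional dependence and conditional independence -/

section Characterizations

variable {Ω : Type*} [MeasurableSpace Ω] {P : Measure Ω} [IsProbabilityMeasure P]
  {E : Type*} [MeasurableSpace E] {G : Type*} [MeasurableSpace G] {Y : Ω → ℝ} {X : Ω → E}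

lemma forall_condDistFun_eq_distFun (hX : Measurable X) (hY : Measurable Y)
    (h : ∀ᵐ y ∂(P.map Y), (fun ω => condDistFun P Y X (X ω) y) =ᵐ[P] fun _ => distFun P Y y)
    (y : ℝ) : (fun ω => condDistFun P Y X (X ω) y) =ᵐ[P] fun _ => distFun P Y y := by
  refine forall_of_ae_of_limit (P.map Y) h (fun y hy => ?_) (fun y s hs hle hQ hnull => ?_) y
  · filter_upwards [condDistFun_eq_zero hX hY hy] with ω hω
    rw [hω, distFun_eq hY, measureReal_def, hy, ENNReal.toReal_zero]
  · filter_upwards [ae_tendsto_condDistFun hX hY hs hle hnull, ae_all_iff.2 hQ] with ω hω hQω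
    simp only [hQω] at hω
    exact tendsto_nhds_unique hω (tendsto_distFun hY hs hle hnull)

lemma forall_condDistFun_eq_condDistFun {X' : Ω → G} (hX : Measurable X) (hX' : Measurable X')
    (hY : Measurable Y)
    (h : ∀ᵐ y ∂(P.map Y), (fun ω => condDistFun P Y X (X ω) y) =ᵐ[P]
      fun ω => condDistFun P Y X' (X' ω) y)
    (y : ℝ) : (fun ω => condDistFun P Y X (X ω) y) =ᵐ[P] fun ω => condDistFun P Y X' (X' ω) y := by
  refine forall_of_ae_of_limit (P.map Y) h (fun y hy => ?_) (fun y s hs hle hQ hnull => ?_) y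
  · filter_upwards [condDistFun_eq_zero hX hY hy, condDistFun_eq_zero hX' hY hy] with ω hω hω'
    rw [hω, hω']
  · filter_upwards [ae_tendsto_condDistFun hX hY hs hle hnull,
      ae_tendsto_condDistFun hX' hY hs hle hnull, ae_all_iff.2 hQ] with ω hω hω' hQω
    simp only [hQω] at hω
    exact tendsto_nhds_unique hω hω'

lemma forall_condDistFun_zero_or_one (hX : Measurable X) (hY : Measurable Y)
    (h : ∀ᵐ y ∂(P.map Y), ∀ᵐ ω ∂P,
      condDistFun P Y X (X ω) y = 0 ∨ condDistFun P Y X (X ω) y = 1) (y : ℝ) :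
    ∀ᵐ ω ∂P, condDistFun P Y X (X ω) y = 0 ∨ condDistFun P Y X (X ω) y = 1 := by
  refine forall_of_ae_of_limit (P.map Y) h (fun y hy => ?_) (fun y s hs hle hQ hnull => ?_) y
  · filter_upwards [condDistFun_eq_zero hX hY hy] with ω hω using Or.inl hω
  · filter_upwards [ae_tendsto_condDistFun hX hY hs hle hnull, ae_all_iff.2 hQ] with ω hω hQω
    have hcl : IsClosed ({0, 1} : Set ℝ) := (toFinite _).isClosed
    exact hcl.mem_of_tendsto hω (Eventually.of_forall hQω)

/-- `X` and `Y` are independent iff the conditional distribution function of `Y` given `X` is a.s.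
the distribution function of `Y`, at almost all levels. -/
lemma ae_condDistFun_eq_distFun_iff_indepFun (hX : Measurable X) (hY : Measurable Y) :
    (∀ᵐ y ∂(P.map Y), (fun ω => condDistFun P Y X (X ω) y) =ᵐ[P] fun _ => distFun P Y y) ↔
      IndepFun X Y P := by
  have := Measure.isProbabilityMeasure_map (μ := P) hY.aemeasurable
  have := Measure.isProbabilityMeasure_map (μ := P) hX.aemeasurable
  rw [indepFun_iff_map_prod_eq_prod_map_map hX.aemeasurable hY.aemeasurable,
    ← Measure.compProd_const,
    ← condDistrib_ae_eq_iff_measure_eq_compProd X hY.aemeasurable]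
  refine ⟨fun h => ?_, fun h => ?_⟩
  · have h2 : ∀ y : ℝ, ∀ᵐ x ∂(P.map X), (condDistrib Y X P x).real (Iic y)
        = (P.map Y).real (Iic y) := fun y => by
      have hm : MeasurableSet {x | (condDistrib Y X P x).real (Iic y) = (P.map Y).real (Iic y)} :=
        measurableSet_eq_fun ((condDistrib Y X P).measurable_coe measurableSet_Iic).ennreal_toReal
          measurable_const
      rw [ae_map_iff hX.aemeasurable hm]
      filter_upwards [forall_condDistFun_eq_distFun hX hY h y] with ω hω
      rw [distFun_eq hY] at hω
      exact hω
    filter_upwards [ae_eq_measure_of_ae_eq_Iic (m' := fun _ => P.map Y) h2] with x hx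
    rw [hx, Kernel.const_apply]
  · refine Eventually.of_forall fun y => ?_
    filter_upwards [ae_of_ae_map hX.aemeasurable h] with ω hω
    rw [condDistFun, hω, Kernel.const_apply, distFun_eq hY]

/-- Events of probability `0` or `1` are closed under complements and disjoint countable unions, so
the rational half-lines suffice by the π-λ theorem. -/
lemma isZeroOneMeasure_of_Iic_rat {m : Measure ℝ} [IsProbabilityMeasure m]
    (h : ∀ q : ℚ, m.real (Iic (q : ℝ)) = 0 ∨ m.real (Iic (q : ℝ)) = 1) : IsZeroOneMeasure m := by
  refine ⟨fun s hs => ?_⟩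
  induction s, hs using MeasurableSpace.induction_on_inter
    ((BorelSpace.measurable_eq (α := ℝ)).trans Real.borel_eq_generateFrom_Iic_rat)
    Real.isPiSystem_Iic_rat with
  | empty => simp
  | basic t ht =>
    simp only [mem_iUnion, mem_singleton_iff] at ht
    obtain ⟨q, rfl⟩ := ht
    rcases h q with h | h
    · exact Or.inl ((measureReal_eq_zero_iff).1 h)
    · right
      rw [measureReal_def] at h
      rw [← ENNReal.ofReal_toReal (measure_ne_top m (Iic (q : ℝ))), h, ENNReal.ofReal_one]
  | compl t ht ih =>
    rcases ih with ih | ih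
    · exact Or.inr ((prob_compl_eq_one_iff ht).2 ih)
    · exact Or.inl ((prob_compl_eq_zero_iff ht).2 ih)
  | iUnion f hd hf ih =>
    by_cases hall : ∀ i, m (f i) = 0
    · exact Or.inl (measure_iUnion_null hall)
    · push Not at hall
      obtain ⟨i, hi⟩ := hall
      refine Or.inr (le_antisymm prob_le_one ?_)
      rw [← (ih i).resolve_left hi]
      exact measure_mono (subset_iUnion f i)

/-- `Y` is a function of `X` iff the conditional distribution function of `Y` given `X` only takes
the values `0` and `1`, at almost all levels. -/
lemma ae_condDistFun_zero_or_one_iff_perfectlyDependent (hX : Measurable X) (hY : Measurable Y) :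
    (∀ᵐ y ∂(P.map Y), ∀ᵐ ω ∂P,
      condDistFun P Y X (X ω) y = 0 ∨ condDistFun P Y X (X ω) y = 1) ↔
      PerfectlyDependent P Y X := by
  refine ⟨fun h => ?_, fun ⟨f, hf, hYf⟩ => ?_⟩
  · have hdirac : ∀ᵐ ω ∂P, ∃ c, condDistrib Y X P (X ω) = Measure.dirac c := by
      filter_upwards [ae_all_iff.2 fun q : ℚ => forall_condDistFun_zero_or_one hX hY h (q : ℝ)]
        with ω hω
      have := isZeroOneMeasure_of_Iic_rat (m := condDistrib Y X P (X ω)) hω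
      exact IsZeroOneMeasure.exists_eq_dirac
    -- The mean of a Dirac law is its atom; this selects the atom measurably.
    let f : E → ℝ := fun x => ∫ t, t ∂(condDistrib Y X P x)
    have hf : Measurable f :=
      (StronglyMeasurable.integral_condDistrib (f := Prod.snd) (μ := P) (X := X) (Y := Y)
        measurable_snd.stronglyMeasurable).measurable
    refine ⟨f, hf, ?_⟩
    have hset : MeasurableSet {z : E × ℝ | z.2 ≠ f z.1} :=
      (measurableSet_eq_fun measurable_snd (hf.comp measurable_fst)).compl
    -- Disintegration: almost every conditional law sits on the graph of `f`, so the joint law does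
    -- too.
    have hnull : P.map (fun ω => (X ω, Y ω)) {z : E × ℝ | z.2 ≠ f z.1} = 0 := by
      rw [← compProd_map_condDistrib hY.aemeasurable, Measure.compProd_apply hset,
        lintegral_map (Kernel.measurable_kernel_prodMk_left hset) hX]
      refine lintegral_eq_zero_of_ae_eq_zero ?_
      filter_upwards [hdirac] with ω ⟨c, hc⟩
      have hfc : f (X ω) = c := by simp only [f, hc, integral_dirac]
      have : Prod.mk (X ω) ⁻¹' {z : E × ℝ | z.2 ≠ f z.1} = {c}ᶜ := by
        ext t
        simp [hfc]
      rw [this, hc]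
      simp
    rw [Measure.map_apply (hX.prodMk hY) hset] at hnull
    exact ae_iff.2 hnull
  · have hk : condDistrib Y X P =ᵐ[P.map X] Kernel.deterministic f hf := by
      rw [condDistrib_congr_left (Y' := f ∘ X) hYf]
      exact condDistrib_comp_self X hf
    refine Eventually.of_forall fun y => ?_
    filter_upwards [ae_of_ae_map hX.aemeasurable hk] with ω hω
    rw [condDistFun, hω, Kernel.deterministic_apply, measureReal_def,
      Measure.dirac_apply' _ measurableSet_Iic]
    by_cases hy : f (X ω) ∈ Iic y <;> simp [hy]

lemma condDistFun_ae_eq_condExp (hX : Measurable X) (hY : Measurable Y) (y : ℝ) :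
    (fun ω => condDistFun P Y X (X ω) y) =ᵐ[P]
      P⟦Y ⁻¹' Iic y | MeasurableSpace.comap X inferInstance⟧ :=
  condDistrib_ae_eq_condExp hX hY measurableSet_Iic

lemma comap_le_comap_prodMk {Ω : Type*} (X : Ω → E) (Z : Ω → G) :
    MeasurableSpace.comap X inferInstance ≤
      MeasurableSpace.comap (fun ω => (X ω, Z ω)) inferInstance := by
  rintro _ ⟨s, hs, rfl⟩
  exact ⟨Prod.fst ⁻¹' s, measurable_fst hs, rfl⟩

lemma comap_le_comap_prodMk_right {Ω : Type*} (X : Ω → E) (Z : Ω → G) :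
    MeasurableSpace.comap Z inferInstance ≤
      MeasurableSpace.comap (fun ω => (X ω, Z ω)) inferInstance := by
  rintro _ ⟨s, hs, rfl⟩
  exact ⟨Prod.snd ⁻¹' s, measurable_snd hs, rfl⟩

/-- The tower property for conditional distribution functions. -/
lemma condExp_condDistFun_prodMk {Z : Ω → G} (hX : Measurable X) (hZ : Measurable Z)
    (hY : Measurable Y) (y : ℝ) :
    P[fun ω => condDistFun P Y (fun ω => (X ω, Z ω)) (X ω, Z ω) y |
      MeasurableSpace.comap X inferInstance] =ᵐ[P] fun ω => condDistFun P Y X (X ω) y := by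
  have hW : Measurable fun ω => (X ω, Z ω) := hX.prodMk hZ
  have h1 := condExp_congr_ae (m := MeasurableSpace.comap X inferInstance)
    (condDistFun_ae_eq_condExp (P := P) hW hY y)
  have h2 := condExp_condExp_of_le (μ := P) (f := (Y ⁻¹' Iic y).indicator fun _ => (1 : ℝ))
    (comap_le_comap_prodMk X Z) hW.comap_le
  exact h1.trans (h2.trans (condDistFun_ae_eq_condExp hX hY y).symm)

lemma integrable_indicator_one {s : Set Ω} (hs : MeasurableSet s) :
    Integrable (s.indicator fun _ => (1 : ℝ)) P :=
  (integrable_const _).indicator hs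

/-- Equal conditional distribution functions give equal conditional laws. So, given `(X, Z)`, the
indicator of `Z ∈ B` pulls out and leaves `P(Y ∈ A | X)`; conditioning further on `X` pulls this out
in turn. -/
lemma condIndepGiven_of_condDistFun_eq {Z : Ω → G} (hX : Measurable X) (hZ : Measurable Z)
    (hY : Measurable Y)
    (h : ∀ y, (fun ω => condDistFun P Y X (X ω) y) =ᵐ[P]
      fun ω => condDistFun P Y (fun ω => (X ω, Z ω)) (X ω, Z ω) y) : CondIndepGiven P Y Z X := by
  intro A B hA hB
  have hW : Measurable fun ω => (X ω, Z ω) := hX.prodMk hZ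
  have hXW := comap_le_comap_prodMk X Z
  have hker := ae_eq_measure_of_ae_eq_Iic (m := fun ω => condDistrib Y X P (X ω))
    (m' := fun ω => condDistrib Y (fun ω => (X ω, Z ω)) P (X ω, Z ω)) h
  have eX := condDistrib_ae_eq_condExp (μ := P) hX hY hA
  have eW := condDistrib_ae_eq_condExp (μ := P) hW hY hA
  have hXWA : P⟦Y ⁻¹' A | MeasurableSpace.comap (fun ω => (X ω, Z ω)) inferInstance⟧ =ᵐ[P] P⟦Y ⁻¹' A | MeasurableSpace.comap X inferInstance⟧ := by
    filter_upwards [hker, eX, eW] with ω h1 h2 h3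
    rw [← h2, ← h3, h1]
  have hZB : StronglyMeasurable[MeasurableSpace.comap (fun ω => (X ω, Z ω)) inferInstance] ((Z ⁻¹' B).indicator fun _ => (1 : ℝ)) :=
    stronglyMeasurable_const.indicator (comap_le_comap_prodMk_right X Z _ ⟨B, hB, rfl⟩)
  have hprod : ((Y ⁻¹' A ∩ Z ⁻¹' B).indicator fun _ => (1 : ℝ)) =
      ((Z ⁻¹' B).indicator fun _ => (1 : ℝ)) * ((Y ⁻¹' A).indicator fun _ => (1 : ℝ)) := by
    ext ω
    by_cases h1 : ω ∈ Y ⁻¹' A <;> by_cases h2 : ω ∈ Z ⁻¹' B <;> simp_all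
  have s1 : P⟦Y ⁻¹' A ∩ Z ⁻¹' B | MeasurableSpace.comap (fun ω => (X ω, Z ω)) inferInstance⟧ =ᵐ[P]
      ((Z ⁻¹' B).indicator fun _ => (1 : ℝ)) * P⟦Y ⁻¹' A | MeasurableSpace.comap X inferInstance⟧ := by
    have := condExp_mul_of_stronglyMeasurable_left (μ := P) hZB
      (by rw [← hprod]; exact integrable_indicator_one ((hY hA).inter (hZ hB)))
      (integrable_indicator_one (hY hA))
    rw [← hprod] at this
    filter_upwards [this, hXWA] with ω h1 h2
    rw [h1, Pi.mul_apply, Pi.mul_apply, h2]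
  have s2 : P⟦Y ⁻¹' A ∩ Z ⁻¹' B | MeasurableSpace.comap X inferInstance⟧ =ᵐ[P]
      P[((Z ⁻¹' B).indicator fun _ => (1 : ℝ)) * P⟦Y ⁻¹' A | MeasurableSpace.comap X inferInstance⟧ | MeasurableSpace.comap X inferInstance] :=
    (condExp_condExp_of_le hXW hW.comap_le).symm.trans (condExp_congr_ae s1)
  have s3 : P[((Z ⁻¹' B).indicator fun _ => (1 : ℝ)) * P⟦Y ⁻¹' A | MeasurableSpace.comap X inferInstance⟧ | MeasurableSpace.comap X inferInstance] =ᵐ[P]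
      P⟦Z ⁻¹' B | MeasurableSpace.comap X inferInstance⟧ * P⟦Y ⁻¹' A | MeasurableSpace.comap X inferInstance⟧ := by
    refine condExp_mul_of_stronglyMeasurable_right stronglyMeasurable_condExp ?_
      (integrable_indicator_one (hZ hB))
    refine (integrable_condExp (μ := P) (m := MeasurableSpace.comap X inferInstance)
      (f := (Y ⁻¹' A).indicator fun _ => (1 : ℝ))).bdd_mul
      ((integrable_indicator_one (hZ hB)).aestronglyMeasurable) (c := 1)
      (Eventually.of_forall fun ω => ?_)
    by_cases h2 : ω ∈ Z ⁻¹' B <;> simp [h2]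
  filter_upwards [s2.trans s3] with ω hω
  rw [hω, Pi.mul_apply, mul_comm]

/-- Given `X`, the variable `1{Z ∈ t} F_{Y|X}(y)` has conditional expectation `P(Y ≤ y, Z ∈ t | X)`
by conditional independence; integrate over `{X ∈ s}`. -/
lemma setIntegral_condDistFun_of_condIndepGiven {Z : Ω → G} (hX : Measurable X)
    (hZ : Measurable Z) (hY : Measurable Y) (h : CondIndepGiven P Y Z X) (y : ℝ) {s : Set E}
    {t : Set G} (hs : MeasurableSet s) (ht : MeasurableSet t) :
    ∫ ω in X ⁻¹' s ∩ Z ⁻¹' t, condDistFun P Y X (X ω) y ∂P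
      = P.real (X ⁻¹' s ∩ Z ⁻¹' t ∩ Y ⁻¹' Iic y) := by
  have hYy : MeasurableSet (Y ⁻¹' Iic y) := hY measurableSet_Iic
  have hXs : MeasurableSet[MeasurableSpace.comap X inferInstance] (X ⁻¹' s) := ⟨s, hs, rfl⟩
  have hp : StronglyMeasurable[MeasurableSpace.comap X inferInstance] fun ω => condDistFun P Y X (X ω) y :=
    ((measurable_condDistrib (Y := Y) (X := X) (μ := P)
      measurableSet_Iic).ennreal_toReal).stronglyMeasurable
  have hprod : ((Z ⁻¹' t).indicator fun ω => condDistFun P Y X (X ω) y) =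
      (fun ω => condDistFun P Y X (X ω) y) * (Z ⁻¹' t).indicator fun _ => (1 : ℝ) := by
    ext ω
    by_cases h2 : ω ∈ Z ⁻¹' t <;> simp [h2]
  have hint : Integrable ((Z ⁻¹' t).indicator fun ω => condDistFun P Y X (X ω) y) P :=
    (integrable_of_mem_Icc (measurable_condDistFun_comp hX y)
      fun ω => condDistFun_mem _ _).indicator (hZ ht)
  have s1 : P[(Z ⁻¹' t).indicator fun ω => condDistFun P Y X (X ω) y | MeasurableSpace.comap X inferInstance] =ᵐ[P]
      (fun ω => condDistFun P Y X (X ω) y) * P⟦Z ⁻¹' t | MeasurableSpace.comap X inferInstance⟧ := by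
    rw [hprod] at hint ⊢
    exact condExp_mul_of_stronglyMeasurable_left hp hint (integrable_indicator_one (hZ ht))
  have s2 : P⟦Y ⁻¹' Iic y ∩ Z ⁻¹' t | MeasurableSpace.comap X inferInstance⟧ =ᵐ[P]
      P[(Z ⁻¹' t).indicator fun ω => condDistFun P Y X (X ω) y | MeasurableSpace.comap X inferInstance] := by
    filter_upwards [h (Iic y) t measurableSet_Iic ht, s1, condDistFun_ae_eq_condExp (P := P) hX hY y]
      with ω h1 h2 h3
    rw [h1, h2, Pi.mul_apply, h3]
  calc ∫ ω in X ⁻¹' s ∩ Z ⁻¹' t, condDistFun P Y X (X ω) y ∂P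
      = ∫ ω in X ⁻¹' s, (Z ⁻¹' t).indicator (fun ω => condDistFun P Y X (X ω) y) ω ∂P :=
        (setIntegral_indicator (hZ ht)).symm
    _ = ∫ ω in X ⁻¹' s, (P[(Z ⁻¹' t).indicator fun ω => condDistFun P Y X (X ω) y | MeasurableSpace.comap X inferInstance]) ω ∂P :=
        (setIntegral_condExp hX.comap_le hint hXs).symm
    _ = ∫ ω in X ⁻¹' s, (P⟦Y ⁻¹' Iic y ∩ Z ⁻¹' t | MeasurableSpace.comap X inferInstance⟧) ω ∂P :=
        (integral_congr_ae (ae_restrict_of_ae s2)).symm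
    _ = ∫ ω in X ⁻¹' s, (Y ⁻¹' Iic y ∩ Z ⁻¹' t).indicator (fun _ => (1 : ℝ)) ω ∂P :=
        setIntegral_condExp hX.comap_le (integrable_indicator_one (hYy.inter (hZ ht))) hXs
    _ = P.real (X ⁻¹' s ∩ Z ⁻¹' t ∩ Y ⁻¹' Iic y) := by
        rw [setIntegral_indicator (hYy.inter (hZ ht)), setIntegral_const, smul_eq_mul, mul_one]
        congr 1
        ext ω
        simp only [mem_inter_iff]
        tauto

lemma condDistFun_ae_eq_of_condIndepGiven {Z : Ω → G} (hX : Measurable X)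
    (hZ : Measurable Z) (hY : Measurable Y) (h : CondIndepGiven P Y Z X) (y : ℝ) :
    (fun ω => condDistFun P Y X (X ω) y) =ᵐ[P]
      fun ω => condDistFun P Y (fun ω => (X ω, Z ω)) (X ω, Z ω) y := by
  have hW : Measurable fun ω => (X ω, Z ω) := hX.prodMk hZ
  have hYy : MeasurableSet (Y ⁻¹' Iic y) := hY measurableSet_Iic
  have hp : Measurable fun ω => condDistrib Y X P (X ω) (Iic y) :=
    measurable_condDistrib_comp hX measurableSet_Iic
  have : IsFiniteMeasure (P.withDensity fun ω => condDistrib Y X P (X ω) (Iic y)) :=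
    isFiniteMeasure_withDensity (by
      rw [lintegral_condDistrib hX hY measurableSet_Iic]
      exact measure_ne_top _ _)
  have hl : ∀ C, MeasurableSet C →
      ((P.withDensity fun ω => condDistrib Y X P (X ω) (Iic y)).map (fun ω => (X ω, Z ω))).real C
        = ∫ ω in (fun ω => (X ω, Z ω)) ⁻¹' C, condDistFun P Y X (X ω) y ∂P := fun C hC => by
    rw [measureReal_def, Measure.map_apply hW hC, withDensity_apply _ (hW hC),
      ← integral_toReal hp.aemeasurable (Eventually.of_forall fun ω => measure_lt_top _ _)]
    rfl
  have hr : ∀ C, MeasurableSet C →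
      ((P.restrict (Y ⁻¹' Iic y)).map (fun ω => (X ω, Z ω))).real C
        = P.real ((fun ω => (X ω, Z ω)) ⁻¹' C ∩ Y ⁻¹' Iic y) := fun C hC => by
    rw [measureReal_def, Measure.map_apply hW hC, Measure.restrict_apply (hW hC), measureReal_def]
  -- Two finite measures on the product that agree on rectangles coincide. Hence `F_{Y|X}(y)` has
  -- the integrals over all `(X, Z)`-events that define the conditional expectation given `(X, Z)`.
  have hmeas : (P.withDensity fun ω => condDistrib Y X P (X ω) (Iic y)).map (fun ω => (X ω, Z ω))
      = (P.restrict (Y ⁻¹' Iic y)).map (fun ω => (X ω, Z ω)) := by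
    refine Measure.ext_prod fun {s t} hs ht => ?_
    rw [← measureReal_eq_measureReal_iff, hl _ (hs.prod ht), hr _ (hs.prod ht)]
    exact setIntegral_condDistFun_of_condIndepGiven hX hZ hY h y hs ht
  have hpi : Integrable (fun ω => condDistFun P Y X (X ω) y) P :=
    integrable_of_mem_Icc (measurable_condDistFun_comp hX y) fun ω => condDistFun_mem _ _
  have hpR : Measurable[MeasurableSpace.comap X inferInstance] fun ω => condDistFun P Y X (X ω) y :=
    (measurable_condDistrib (Y := Y) (X := X) (μ := P) measurableSet_Iic).ennreal_toReal
  refine (ae_eq_condExp_of_forall_setIntegral_eq hW.comap_le (integrable_indicator_one hYy)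
    (fun _ _ _ => hpi.integrableOn) ?_
    (hpR.mono (comap_le_comap_prodMk X Z) le_rfl).stronglyMeasurable.aestronglyMeasurable).trans
    (condDistFun_ae_eq_condExp hW hY y).symm
  rintro _ ⟨C, hC, rfl⟩ -
  rw [← hl C hC, hmeas, hr C hC, setIntegral_indicator hYy, setIntegral_const, smul_eq_mul, mul_one]

/-- Conditional independence in terms of the conditional distribution functions of `Y`. -/
lemma ae_condDistFun_eq_iff_condIndepGiven {Z : Ω → G} (hX : Measurable X) (hZ : Measurable Z)
    (hY : Measurable Y) :
    (∀ᵐ y ∂(P.map Y), (fun ω => condDistFun P Y X (X ω) y) =ᵐ[P]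
      fun ω => condDistFun P Y (fun ω => (X ω, Z ω)) (X ω, Z ω) y) ↔ CondIndepGiven P Y Z X :=
  ⟨fun h => condIndepGiven_of_condDistFun_eq hX hZ hY
    (forall_condDistFun_eq_condDistFun hX (hX.prodMk hZ) hY h),
    fun h => Eventually.of_forall (condDistFun_ae_eq_of_condIndepGiven hX hZ hY h)⟩

end Characterizations

/-! ### Quantile transform and atoms -/

section Quantiles

variable {Ω : Type*} [MeasurableSpace Ω] {P : Measure Ω} [IsProbabilityMeasure P]
  {E : Type*} [MeasurableSpace E] {Y : Ω → ℝ} {X : Ω → E} {v w y : ℝ}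

lemma quantile_le_iff {P : Measure Ω} (hv : v ∈ Ioo (0 : ℝ) 1) :
    quantile P Y v ≤ y ↔ v ≤ distFun P Y y := by
  have hne : {y : ℝ | v ≤ distFun P Y y}.Nonempty :=
    (((tendsto_cdf_atTop (P.map Y)).eventually (lt_mem_nhds hv.2)).exists).imp fun _ h => le_of_lt h
  have hbdd : BddBelow {y : ℝ | v ≤ distFun P Y y} := by
    obtain ⟨b, hb⟩ := ((tendsto_cdf_atBot (P.map Y)).eventually (gt_mem_nhds hv.1)).exists
    refine ⟨b, fun x hx => ?_⟩
    by_contra! hlt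
    exact absurd (lt_of_le_of_lt (monotone_distFun hlt.le) hb) (not_lt.2 hx)
  refine ⟨fun h => ?_, fun h => csInf_le hbdd h⟩
  -- Right continuity of the distribution function makes the infimum attained.
  refine ge_of_tendsto (((cdf (P.map Y)).right_continuous y).tendsto.mono_left
    (nhdsWithin_mono y Ioi_subset_Ici_self)) ?_
  filter_upwards [self_mem_nhdsWithin] with x hx
  obtain ⟨z, hz, hzx⟩ := exists_lt_of_csInf_lt hne (lt_of_le_of_lt h hx)
  exact le_trans hz (monotone_distFun hzx.le)

lemma lt_quantile_iff {P : Measure Ω} (hv : v ∈ Ioo (0 : ℝ) 1) :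
    y < quantile P Y v ↔ distFun P Y y < v := by
  rw [← not_le, quantile_le_iff hv, not_le]

lemma le_distFun_quantile {P : Measure Ω} (hv : v ∈ Ioo (0 : ℝ) 1) : v ≤ distFun P Y (quantile P Y v) :=
  (quantile_le_iff hv).1 le_rfl

lemma monotoneOn_quantile {P : Measure Ω} : MonotoneOn (quantile P Y) (Ioo 0 1) := fun _ hv _ hw h =>
  (quantile_le_iff hv).2 (h.trans (le_distFun_quantile hw))

lemma aemeasurable_quantile {P : Measure Ω} : AEMeasurable (quantile P Y) (volume.restrict (Ioo 0 1)) :=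
  aemeasurable_restrict_of_monotoneOn measurableSet_Ioo monotoneOn_quantile

/-- The quantile transform. -/
lemma map_quantile (hY : Measurable Y) :
    (volume.restrict (Ioo (0 : ℝ) 1)).map (quantile P Y) = P.map Y := by
  have := Measure.isProbabilityMeasure_map (μ := P) hY.aemeasurable
  refine Measure.ext_of_Iic _ _ fun y => ?_
  have hq : quantile P Y ⁻¹' Iic y ∩ Ioo 0 1 = Iic (distFun P Y y) ∩ Ioo 0 1 := by
    ext v
    simp only [mem_inter_iff, mem_preimage, mem_Iic]
    exact ⟨fun h => ⟨(quantile_le_iff h.2).1 h.1, h.2⟩, fun h => ⟨(quantile_le_iff h.2).2 h.1, h.2⟩⟩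
  rw [Measure.map_apply_of_aemeasurable aemeasurable_quantile measurableSet_Iic,
    Measure.restrict_apply₀' measurableSet_Ioo.nullMeasurableSet, hq]
  have hF := distFun_mem (P := P) (Y := Y) y
  have hR : P.map Y (Iic y) = ENNReal.ofReal (distFun P Y y) := by
    rw [distFun_eq hY, measureReal_def, ENNReal.ofReal_toReal (measure_ne_top _ _)]
  rw [hR]
  refine le_antisymm ?_ ?_
  · calc volume (Iic (distFun P Y y) ∩ Ioo 0 1) ≤ volume (Ioc 0 (distFun P Y y)) :=
          measure_mono fun v hv => ⟨hv.2.1, hv.1⟩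
      _ = _ := by rw [Real.volume_Ioc, sub_zero]
  · calc ENNReal.ofReal (distFun P Y y) = volume (Ioo 0 (distFun P Y y)) := by
          rw [Real.volume_Ioo, sub_zero]
      _ ≤ volume (Iic (distFun P Y y) ∩ Ioo 0 1) :=
          measure_mono fun v hv => ⟨hv.2.le, hv.1, hv.2.trans_le hF.2⟩

lemma integral_map_quantile (hY : Measurable Y) {H : ℝ → ℝ} (hH : Measurable H) :
    ∫ y, H y ∂(P.map Y) = ∫ v in Ioo (0 : ℝ) 1, H (quantile P Y v) := by
  rw [← map_quantile hY, integral_map aemeasurable_quantile hH.aestronglyMeasurable]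

lemma integrable_comp_quantile (hY : Measurable Y) {H : ℝ → ℝ} (hH : Integrable H (P.map Y)) :
    Integrable (fun v => H (quantile P Y v)) (volume.restrict (Ioo (0 : ℝ) 1)) := by
  rw [← map_quantile hY] at hH
  exact hH.comp_aemeasurable aemeasurable_quantile

/-- The probability `P(Y < q_Y(v))`. -/
def belowQuantile (P : Measure Ω) (Y : Ω → ℝ) (v : ℝ) : ℝ := (P.map Y).real (Iio (quantile P Y v))

/-- Each `y` below the quantile has `F_Y(y) < v`, and `P(Y < q_Y(v))` is the limit of such values.
-/
lemma belowQuantile_le (hY : Measurable Y) (hv : v ∈ Ioo (0 : ℝ) 1) : belowQuantile P Y v ≤ v := by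
  have := Measure.isProbabilityMeasure_map (μ := P) hY.aemeasurable
  have hmono : Monotone fun n : ℕ => Iic (quantile P Y v - 1 / ((n : ℝ) + 1)) :=
    fun m n h => Iic_subset_Iic.2 (sub_le_sub_left (Nat.one_div_le_one_div h) _)
  refine le_of_tendsto' (tendsto_measureReal_of_monotone (P.map Y) hmono
    (V := Iio (quantile P Y v)) (fun n x hx => ?_) ?_) (fun n => ?_)
  · have : (0 : ℝ) < 1 / ((n : ℝ) + 1) := Nat.one_div_pos_of_nat
    simp only [mem_Iic, mem_Iio] at *
    linarith
  · have : Iio (quantile P Y v) \ ⋃ n : ℕ, Iic (quantile P Y v - 1 / ((n : ℝ) + 1)) = ∅ := by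
      rw [sdiff_eq_empty]
      intro x hx
      obtain ⟨n, hn⟩ := exists_nat_one_div_lt (sub_pos.2 (mem_Iio.1 hx))
      exact mem_iUnion.2 ⟨n, by simp only [mem_Iic]; linarith⟩
    rw [this, measure_empty]
  · rw [← distFun_eq hY]
    refine ((lt_quantile_iff hv).1 ?_).le
    have : (0 : ℝ) < 1 / ((n : ℝ) + 1) := Nat.one_div_pos_of_nat
    linarith

lemma distFun_le_belowQuantile (hY : Measurable Y) (h : y < quantile P Y v) :
    distFun P Y y ≤ belowQuantile P Y v := by
  have := Measure.isProbabilityMeasure_map (μ := P) hY.aemeasurable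
  rw [distFun_eq hY]
  exact measureReal_mono fun x hx => lt_of_le_of_lt hx h

lemma measureReal_Ici_quantile (hY : Measurable Y) :
    (P.map Y).real (Ici (quantile P Y v)) = 1 - belowQuantile P Y v := by
  have := Measure.isProbabilityMeasure_map (μ := P) hY.aemeasurable
  rw [← compl_Iio, probReal_compl_eq_one_sub measurableSet_Iio, belowQuantile]

/-- The distribution functions at the quantiles are determined, up to countably many levels, by the
probabilities of falling below the quantiles. -/
lemma countable_distFun_quantile_lt {Ω' : Type*} [MeasurableSpace Ω'] {P' : Measure Ω'}
    [IsProbabilityMeasure P'] {Y' : Ω' → ℝ} (hY : Measurable Y) (hY' : Measurable Y')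
    (h : ∀ v ∈ Ioo (0 : ℝ) 1, belowQuantile P Y v = belowQuantile P' Y' v) :
    {v ∈ Ioo (0 : ℝ) 1 | distFun P Y (quantile P Y v) <
      distFun P' Y' (quantile P' Y' v)}.Countable := by
  have := Measure.isProbabilityMeasure_map (μ := P') hY'.aemeasurable
  have hatoms : {x : ℝ | 0 < (P'.map Y') {x}}.Countable := by
    simpa using Measure.countable_meas_level_set_pos (μ := P'.map Y') (g := id) measurable_id
  -- Each exceptional `v` is recovered from an atom `x` of the second law as `P'(Y' < x)`, and atoms
  -- are countable.
  refine (hatoms.image fun x => (P'.map Y').real (Iio x)).mono fun v ⟨hv, hlt⟩ => ?_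
  have hv1 := le_distFun_quantile (P := P) (Y := Y) hv
  set u := distFun P Y (quantile P Y v) with hu
  set u' := distFun P' Y' (quantile P' Y' v) with hu'
  have hu1 : u' ≤ 1 := (distFun_mem _).2
  -- At a level strictly between `u` and `u'` the second quantile has not moved while the first has
  -- jumped. As the probabilities below the quantiles agree, `u ≤ P(Y < q_Y(v)) ≤ v ≤ u`, so `v` is
  -- the lower end of a jump of the second distribution function.
  have hw : (u + u') / 2 ∈ Ioo (0 : ℝ) 1 := ⟨by linarith [hv.1], by linarith⟩
  have hq' : quantile P' Y' ((u + u') / 2) = quantile P' Y' v :=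
    le_antisymm ((quantile_le_iff hw).2 (by linarith))
      (monotoneOn_quantile hv hw (by linarith))
  have hq : quantile P Y v < quantile P Y ((u + u') / 2) := (lt_quantile_iff hw).2 (by linarith)
  have h1 := distFun_le_belowQuantile hY hq
  have h2 : belowQuantile P Y ((u + u') / 2) = belowQuantile P Y v := by
    rw [h _ hw, h _ hv, belowQuantile, hq', belowQuantile]
  have h3 := belowQuantile_le (P := P) hY hv
  have h4 : belowQuantile P' Y' v = v := by
    rw [← h _ hv]
    linarith
  refine ⟨quantile P' Y' v, ?_, h4⟩
  have h5 : u' = v + (P'.map Y').real {quantile P' Y' v} := by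
    rw [hu', distFun_eq hY', ← Iio_union_right, measureReal_union (by simp) (measurableSet_singleton _)]
    rw [belowQuantile] at h4
    rw [h4]
  have h6 : 0 < (P'.map Y').real {quantile P' Y' v} := by linarith
  exact (ENNReal.toReal_pos_iff.1 h6).1

/-- Levels that decrease strictly to `u`. -/
def levelAbove (u : ℝ) (n : ℕ) : ℝ := u + (1 - u) / ((n : ℝ) + 2)

lemma levelAbove_mem {u : ℝ} (h0 : 0 < u) (h1 : u < 1) (n : ℕ) : levelAbove u n ∈ Ioo (0 : ℝ) 1 := by
  have hn : (0 : ℝ) ≤ n := n.cast_nonneg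
  have hpos : 0 < (1 - u) / ((n : ℝ) + 2) := div_pos (by linarith) (by linarith)
  have hlt : (1 - u) / ((n : ℝ) + 2) < 1 - u := div_lt_self (by linarith) (by linarith)
  unfold levelAbove
  exact ⟨by linarith, by linarith⟩

lemma lt_levelAbove {u : ℝ} (h1 : u < 1) (n : ℕ) : u < levelAbove u n := by
  have hn : (0 : ℝ) ≤ n := n.cast_nonneg
  have hpos : 0 < (1 - u) / ((n : ℝ) + 2) := div_pos (by linarith) (by linarith)
  unfold levelAbove
  linarith

lemma antitone_levelAbove {u : ℝ} (h1 : u < 1) : Antitone (levelAbove u) := fun m n h => by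
  have hm : (0 : ℝ) ≤ m := m.cast_nonneg
  have h' : (m : ℝ) ≤ n := Nat.cast_le.2 h
  unfold levelAbove
  gcongr

lemma tendsto_levelAbove (u : ℝ) : Tendsto (levelAbove u) atTop (𝓝 u) := by
  have : Tendsto (fun n : ℕ => (1 - u) / ((n : ℝ) + 2)) atTop (𝓝 0) :=
    tendsto_const_nhds.div_atTop (tendsto_atTop_add_const_right _ _ tendsto_natCast_atTop_atTop)
  have h2 := tendsto_const_nhds (x := u) |>.add this
  rw [add_zero] at h2
  exact h2

/-- As levels decrease to `u = F_Y(q_Y(v))`, the events `Y ≥ q` increase, up to a null set, to the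
strict event `Y > q_Y(v)`, which is complementary to the one defining the distribution function. -/
lemma ae_tendsto_condSurvival (hX : Measurable X) (hY : Measurable Y) (hv : v ∈ Ioo (0 : ℝ) 1)
    {u : ℝ} (hu : distFun P Y (quantile P Y v) = u) (h1 : u < 1) :
    ∀ᵐ ω ∂P, Tendsto (fun n => condSurvival P Y X (quantile P Y (levelAbove u n)) ω) atTop
      (𝓝 (1 - condDistFun P Y X (X ω) (quantile P Y v))) := by
  have := Measure.isProbabilityMeasure_map (μ := P) hY.aemeasurable
  have h0 : 0 < u := hu ▸ hv.1.trans_le (le_distFun_quantile hv)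
  have hmem := levelAbove_mem h0 h1
  have hmono : Monotone fun n => Ici (quantile P Y (levelAbove u n)) := fun m n h =>
    Ici_subset_Ici.2 (monotoneOn_quantile (hmem n) (hmem m) (antitone_levelAbove h1 h))
  have hsub : ∀ n, Ici (quantile P Y (levelAbove u n)) ⊆ Ioi (quantile P Y v) := fun n x hx =>
    lt_of_lt_of_le ((lt_quantile_iff (hmem n)).2 (hu ▸ lt_levelAbove h1 n)) hx
  -- Since `P(Y ≥ q_Y(w)) ≥ 1 - w`, the union has at least the mass `1 - u` of `Y > q_Y(v)` and is
  -- contained in that event.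
  have hU : 1 - u ≤ (P.map Y).real (⋃ n, Ici (quantile P Y (levelAbove u n))) := by
    refine le_of_tendsto' (tendsto_const_nhds.sub (tendsto_levelAbove u)) fun n => ?_
    calc 1 - levelAbove u n ≤ 1 - belowQuantile P Y (levelAbove u n) :=
          sub_le_sub_left (belowQuantile_le hY (hmem n)) 1
      _ = (P.map Y).real (Ici (quantile P Y (levelAbove u n))) := (measureReal_Ici_quantile hY).symm
      _ ≤ _ := measureReal_mono (subset_iUnion
          (fun n => Ici (quantile P Y (levelAbove u n))) n)
  have hIoi : (P.map Y).real (Ioi (quantile P Y v)) = 1 - u := by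
    rw [← compl_Iic, probReal_compl_eq_one_sub measurableSet_Iic, ← distFun_eq hY, hu]
  have hnull : P.map Y (Ioi (quantile P Y v) \ ⋃ n, Ici (quantile P Y (levelAbove u n))) = 0 := by
    rw [← measureReal_eq_zero_iff, measureReal_sdiff (iUnion_subset hsub)
      (MeasurableSet.iUnion fun n => measurableSet_Ici), hIoi]
    refine le_antisymm (by linarith) ?_
    have := measureReal_mono (μ := P.map Y) (iUnion_subset hsub)
    linarith
  filter_upwards [ae_tendsto_condDistrib hX hY hmono (fun n => measurableSet_Ici)
    measurableSet_Ioi hsub hnull] with ω hω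
  rw [← compl_Iic, probReal_compl_eq_one_sub measurableSet_Iic] at hω
  exact hω

end Quantiles

/-! ### Consequences of the conditional convex order -/

section CondConvexOrder

variable {Ω : Type*} [MeasurableSpace Ω] {P : Measure Ω} [IsProbabilityMeasure P]
  {E : Type*} [MeasurableSpace E] {Y : Ω → ℝ} {X : Ω → E}
  {Ω' : Type*} [MeasurableSpace Ω'] {P' : Measure Ω'} [IsProbabilityMeasure P']
  {E' : Type*} [MeasurableSpace E'] {Y' : Ω' → ℝ} {X' : Ω' → E'}

/-- The test functions `t` and `-t` force equal means, and the mean of `P(Y ≥ q | X)` is `P(Y ≥ q)`.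
-/
lemma CondConvexOrder.belowQuantile_eq (h : CondConvexOrder P Y X P' Y' X')
    (hX : Measurable X) (hY : Measurable Y) (hX' : Measurable X') (hY' : Measurable Y') :
    ∀ v ∈ Ioo (0 : ℝ) 1, belowQuantile P Y v = belowQuantile P' Y' v := by
  intro v hv
  have h1 := h v hv id (convexOn_id convex_univ)
  have h2 := h v hv (fun t => -t) ((concaveOn_id convex_univ).neg)
  simp only [id, integral_neg, condSurvival] at h1 h2
  rw [integral_condDistrib_real hX hY measurableSet_Ici,
    integral_condDistrib_real hX' hY' measurableSet_Ici, measureReal_Ici_quantile hY,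
    measureReal_Ici_quantile hY'] at h1 h2
  linarith

lemma CondConvexOrder.ae_distFun_eq (h : CondConvexOrder P Y X P' Y' X')
    (hX : Measurable X) (hY : Measurable Y) (hX' : Measurable X') (hY' : Measurable Y') :
    ∀ᵐ v ∂(volume.restrict (Ioo (0 : ℝ) 1)),
      distFun P Y (quantile P Y v) = distFun P' Y' (quantile P' Y' v) := by
  have hb := h.belowQuantile_eq hX hY hX' hY'
  have c1 := countable_distFun_quantile_lt hY hY' hb
  have c2 := countable_distFun_quantile_lt hY' hY fun v hv => (hb v hv).symm
  rw [ae_restrict_iff' measurableSet_Ioo]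
  filter_upwards [c1.ae_notMem volume, c2.ae_notMem volume] with v h1 h2 hv
  by_contra hne
  rcases lt_or_gt_of_ne hne with hlt | hlt
  exacts [h1 ⟨hv, hlt⟩, h2 ⟨hv, hlt⟩]

lemma condSurvival_mem (y : ℝ) (ω : Ω) : condSurvival P Y X y ω ∈ Icc (0 : ℝ) 1 :=
  measureReal_mem_unitInterval _ _

lemma ae_condDistFun_eq_one (hX : Measurable X) (hY : Measurable Y) {y : ℝ}
    (h : distFun P Y y = 1) : ∀ᵐ ω ∂P, condDistFun P Y X (X ω) y = 1 :=
  (integral_eq_iff_ae_eq_of_le (integrable_of_mem_Icc (measurable_condDistFun_comp hX y)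
    fun ω => condDistFun_mem _ _) (integrable_const _) fun ω => (condDistFun_mem (X ω) y).2).1
    (by rw [integral_condDistFun hX hY, h]; simp)

lemma tendsto_integral_condSurvival (hX : Measurable X) (hY : Measurable Y) {v : ℝ}
    (hv : v ∈ Ioo (0 : ℝ) 1) {u : ℝ} (hu : distFun P Y (quantile P Y v) = u) (h1 : u < 1)
    {ψ : ℝ → ℝ} (hψ : Continuous ψ) :
    Tendsto (fun n => ∫ ω, ψ (1 - condSurvival P Y X (quantile P Y (levelAbove u n)) ω) ∂P) atTop
      (𝓝 (∫ ω, ψ (condDistFun P Y X (X ω) (quantile P Y v)) ∂P)) := by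
  obtain ⟨C, hC⟩ := isCompact_Icc.exists_bound_of_continuousOn (s := Icc (0 : ℝ) 1)
    hψ.continuousOn
  refine tendsto_integral_of_dominated_convergence (fun _ => C) (fun n => ?_)
    (integrable_const _) (fun n => Eventually.of_forall fun ω => hC _ ?_) ?_
  · exact (hψ.measurable.comp (measurable_const.sub
      (measurable_condDistrib_real_comp hX measurableSet_Ici))).aestronglyMeasurable
  · have := condSurvival_mem (P := P) (Y := Y) (X := X) (quantile P Y (levelAbove u n)) ω
    exact ⟨by linarith [this.2], by linarith [this.1]⟩
  · filter_upwards [ae_tendsto_condSurvival hX hY hv hu h1] with ω hω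
    have := (hψ.tendsto _).comp (tendsto_const_nhds (x := (1 : ℝ)) |>.sub hω)
    rw [sub_sub_cancel] at this
    exact this

/-- The conditional convex order passes to the conditional distribution functions at almost all
quantile levels. -/
lemma CondConvexOrder.convexOrder_condDistFun (h : CondConvexOrder P Y X P' Y' X')
    (hX : Measurable X) (hY : Measurable Y) (hX' : Measurable X') (hY' : Measurable Y') {v : ℝ}
    (hv : v ∈ Ioo (0 : ℝ) 1)
    (heq : distFun P Y (quantile P Y v) = distFun P' Y' (quantile P' Y' v)) :
    ConvexOrder P (fun ω => condDistFun P Y X (X ω) (quantile P Y v))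
      P' (fun ω => condDistFun P' Y' X' (X' ω) (quantile P' Y' v)) := by
  intro ψ hψ
  have hc := continuous_of_convexOn_univ hψ
  rcases (distFun_mem (P := P) (Y := Y) (quantile P Y v)).2.eq_or_lt with h1 | h1
  -- If `u = 1` no level remains above `u`, but both variables are a.s. `1`.
  · rw [integral_congr_ae (g := fun _ => ψ 1)
        (by filter_upwards [ae_condDistFun_eq_one hX hY h1] with ω hω; rw [hω]),
      integral_congr_ae (f := fun ω => ψ (condDistFun P' Y' X' (X' ω) (quantile P' Y' v)))
        (g := fun _ => ψ 1)
        (by filter_upwards [ae_condDistFun_eq_one hX' hY' (heq ▸ h1)] with ω hω; rw [hω])]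
    simp
  · refine le_of_tendsto_of_tendsto' (tendsto_integral_condSurvival hX hY hv rfl h1 hc)
      (tendsto_integral_condSurvival hX' hY' hv heq.symm h1 hc) fun n => ?_
    exact h _ (levelAbove_mem (hv.1.trans_le (le_distFun_quantile hv)) h1 n) _
      (convexOn_univ_sub_left hψ 1)

end CondConvexOrder

/-! ### Normalizers, axioms, monotonicity and conditional independence -/

section MainResults

variable {Ω : Type*} [MeasurableSpace Ω] {P : Measure Ω} [IsProbabilityMeasure P]
  {E : Type*} [MeasurableSpace E] {Y : Ω → ℝ} {X : Ω → E} {φ : ℝ → ℝ}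

/-- If `F_Y(q_Y(v)) = 1`, then `q_Y(v)` dominates every other quantile; if this holds for almost all
`v`, the quantile function is a.e. constant, and its law is that of `Y`. -/
lemma degenerate_of_distFun_quantile_eq_one (hY : Measurable Y)
    (h : ∀ᵐ v ∂(volume.restrict (Ioo (0 : ℝ) 1)), distFun P Y (quantile P Y v) = 1) :
    Degenerate P Y := by
  have hmem : ∀ᵐ v ∂(volume.restrict (Ioo (0 : ℝ) 1)), v ∈ Ioo (0 : ℝ) 1 :=
    ae_restrict_mem measurableSet_Ioo
  have hne : (volume.restrict (Ioo (0 : ℝ) 1)) ≠ 0 := by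
    rw [Ne, Measure.restrict_eq_zero, Real.volume_Ioo]
    simp
  have : NeBot (ae (volume.restrict (Ioo (0 : ℝ) 1))) := ae_neBot.2 hne
  obtain ⟨v₀, h₀, hv₀⟩ := (h.and hmem).exists
  have hconst : ∀ᵐ v ∂(volume.restrict (Ioo (0 : ℝ) 1)), quantile P Y v = quantile P Y v₀ := by
    filter_upwards [h, hmem] with v h1 hv
    exact le_antisymm ((quantile_le_iff hv).2 (h₀ ▸ hv.2.le))
      ((quantile_le_iff hv₀).2 (h1 ▸ hv₀.2.le))
  refine ⟨quantile P Y v₀, ?_⟩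
  have hmap : ∀ᵐ y ∂(P.map Y), y = quantile P Y v₀ := by
    rw [← map_quantile hY]
    exact (ae_map_iff aemeasurable_quantile (measurableSet_singleton (quantile P Y v₀))).2 hconst
  exact ae_of_ae_map hY.aemeasurable hmap

/-- A zero integral forces `F_Y(q_Y(v))` out of `(0, 1)` for almost all `v`; as it is at least `v >
0`, it equals `1`, and `Y` is degenerate. -/
lemma integral_distFun_pos (hY : Measurable Y) (hYnd : ¬ Degenerate P Y) {a : ℝ → ℝ}
    (ha : ∀ u ∈ Icc (0 : ℝ) 1, 0 ≤ a u) (ha' : ∀ u ∈ Ioo (0 : ℝ) 1, 0 < a u)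
    (hi : Integrable (fun y => a (distFun P Y y)) (P.map Y)) :
    0 < ∫ y, a (distFun P Y y) ∂(P.map Y) := by
  refine lt_of_le_of_ne (integral_nonneg fun y => ha _ (distFun_mem y)) fun h0 => hYnd ?_
  have h1 := (integral_eq_zero_iff_of_nonneg (fun y => ha _ (distFun_mem y)) hi).1 h0.symm
  rw [← map_quantile hY] at h1
  refine degenerate_of_distFun_quantile_eq_one hY ?_
  filter_upwards [ae_of_ae_map aemeasurable_quantile h1, ae_restrict_mem measurableSet_Ioo]
    with v hv hvm
  by_contra hne
  exact (ha' _ ⟨hvm.1.trans_le (le_distFun_quantile hvm),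
    lt_of_le_of_ne (distFun_mem _).2 hne⟩).ne' hv

lemma alphaPhi_pos (hφ : ConvexOn ℝ (Icc (-1) 1) φ) (hs : StrictConvexOnAt (Icc (-1) 1) φ 0)
    (h0 : φ 0 = 0) (hY : Measurable Y) (hYnd : ¬ Degenerate P Y) : 0 < alphaPhi φ P Y := by
  have := Measure.isProbabilityMeasure_map (μ := P) hY.aemeasurable
  rw [alphaPhi_eq hφ hs h0 hY]
  refine integral_distFun_pos hY hYnd (fun u hu => ?_) (fun u hu => hs.two_point_pos h0 hu)
    (integrable_alphaAt_distFun hφ _)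
  have := convexOn_sub_le_two_point hφ hu hu
  rwa [sub_self, h0] at this

lemma betaPhi_pos (hφ : ConvexOn ℝ (Icc (-1) 1) φ) (hs : StrictConvexOnAt (Icc (-1) 1) φ 0)
    (h0 : φ 0 = 0) (hY : Measurable Y) (hYnd : ¬ Degenerate P Y) : 0 < betaPhi φ P Y := by
  have := Measure.isProbabilityMeasure_map (μ := P) hY.aemeasurable
  rw [betaPhi_eq hφ hs h0 hY]
  have hpos := hs.endpoints_pos h0
  exact integral_distFun_pos hY hYnd
    (fun u hu => mul_nonneg (mul_nonneg hu.1 (sub_nonneg.2 hu.2)) hpos.le)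
    (fun u hu => mul_pos (mul_pos hu.1 (sub_pos.2 hu.2)) hpos) (integrable_betaAt_distFun _)

lemma integral_bounds_iff {μ : Measure ℝ} [IsProbabilityMeasure μ] {A a : ℝ → ℝ} {Q R : ℝ → Prop}
    (hA : Integrable A μ) (ha : Integrable a μ) (hpos : 0 < ∫ y, a y ∂μ)
    (hlow : ∀ y, 0 ≤ A y ∧ (A y = 0 ↔ Q y)) (hup : ∀ y, A y ≤ a y ∧ (A y = a y ↔ R y)) :
    ((∫ y, a y ∂μ)⁻¹ * ∫ y, A y ∂μ) ∈ Icc (0 : ℝ) 1 ∧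
      ((∫ y, a y ∂μ)⁻¹ * ∫ y, A y ∂μ = 0 ↔ ∀ᵐ y ∂μ, Q y) ∧
      ((∫ y, a y ∂μ)⁻¹ * ∫ y, A y ∂μ = 1 ↔ ∀ᵐ y ∂μ, R y) := by
  have h1 : 0 ≤ ∫ y, A y ∂μ := integral_nonneg fun y => (hlow y).1
  have h2 : ∫ y, A y ∂μ ≤ ∫ y, a y ∂μ := integral_mono hA ha fun y => (hup y).1
  refine ⟨⟨by positivity, ?_⟩, ?_, ?_⟩
  · rw [inv_mul_le_iff₀ hpos, mul_one]
    exact h2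
  · rw [mul_eq_zero, or_iff_right (inv_ne_zero hpos.ne'),
      integral_eq_zero_iff_of_nonneg (fun y => (hlow y).1) hA]
    exact eventually_congr (Eventually.of_forall fun y => (hlow y).2)
  · rw [inv_mul_eq_one₀ hpos.ne', eq_comm, integral_eq_iff_ae_eq_of_le hA ha fun y => (hup y).1]
    exact eventually_congr (Eventually.of_forall fun y => (hup y).2)

/-- Range, zero-independence and max-functionality of `ξ_φ`. -/
theorem xiPhi_axioms (hφ : ConvexOn ℝ (Icc (-1) 1) φ) (hs : StrictConvexOnAt (Icc (-1) 1) φ 0)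
    (h0 : φ 0 = 0) (hX : Measurable X) (hY : Measurable Y) (hYnd : ¬ Degenerate P Y) :
    xiPhi φ P Y X ∈ Icc (0 : ℝ) 1 ∧ (xiPhi φ P Y X = 0 ↔ IndepFun X Y P) ∧
      (xiPhi φ P Y X = 1 ↔ PerfectlyDependent P Y X) := by
  have := Measure.isProbabilityMeasure_map (μ := P) hY.aemeasurable
  have hpos := alphaPhi_pos hφ hs h0 hY hYnd
  rw [← ae_condDistFun_eq_distFun_iff_indepFun hX hY,
    ← ae_condDistFun_zero_or_one_iff_perfectlyDependent hX hY, xiPhi_eq hφ hX hY]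
  rw [alphaPhi_eq hφ hs h0 hY] at hpos ⊢
  exact integral_bounds_iff (integrable_xiAt hφ hX _) (integrable_alphaAt_distFun hφ _) hpos
    (fun y => integral_convex_sub_mean hφ hs h0 (measurable_condDistFun_comp hX y)
      (fun ω => condDistFun_mem _ _) (integral_condDistFun hX hY y))
    (fun y => integral_convex_sub_mean_le hφ hs h0 (measurable_condDistFun_comp hX y)
      (fun ω => condDistFun_mem _ _) (integral_condDistFun hX hY y))

/-- Range, zero-independence and max-functionality of `Λ_φ`. -/
theorem lambdaPhi_axioms (hφ : ConvexOn ℝ (Icc (-1) 1) φ) (hs : StrictConvexOnAt (Icc (-1) 1) φ 0)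
    (h0 : φ 0 = 0) (hX : Measurable X) (hY : Measurable Y) (hYnd : ¬ Degenerate P Y) :
    lambdaPhi φ P Y X ∈ Icc (0 : ℝ) 1 ∧ (lambdaPhi φ P Y X = 0 ↔ IndepFun X Y P) ∧
      (lambdaPhi φ P Y X = 1 ↔ PerfectlyDependent P Y X) := by
  have := Measure.isProbabilityMeasure_map (μ := P) hY.aemeasurable
  have hpos := betaPhi_pos hφ hs h0 hY hYnd
  rw [← ae_condDistFun_eq_distFun_iff_indepFun hX hY,
    ← ae_condDistFun_zero_or_one_iff_perfectlyDependent hX hY, lambdaPhi_eq hφ hX hY]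
  rw [betaPhi_eq hφ hs h0 hY] at hpos ⊢
  exact integral_bounds_iff (integrable_lambdaAt hφ hX _) (integrable_betaAt_distFun _) hpos
    (fun y => integral_convex_sub_copy hφ hs h0 (measurable_condDistFun_comp hX y)
      (fun ω => condDistFun_mem _ _) (integral_condDistFun hX hY y))
    (fun y => integral_convex_sub_copy_le hφ hs h0 (measurable_condDistFun_comp hX y)
      (fun ω => condDistFun_mem _ _) (integral_condDistFun hX hY y))

section Monotonicity

variable {Ω' : Type*} [MeasurableSpace Ω'] {P' : Measure Ω'} [IsProbabilityMeasure P']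
  {E' : Type*} [MeasurableSpace E'] {Y' : Ω' → ℝ} {X' : Ω' → E'}

/-- Both normalizers depend only on `v ↦ F(q(v))`, which the order determines almost everywhere. So
non-degeneracy of `Y` alone makes the normalizers on both sides positive. -/
lemma CondConvexOrder.normalizers_eq (h : CondConvexOrder P Y X P' Y' X')
    (hφ : ConvexOn ℝ (Icc (-1) 1) φ) (hs : StrictConvexOnAt (Icc (-1) 1) φ 0) (h0 : φ 0 = 0)
    (hX : Measurable X) (hY : Measurable Y) (hX' : Measurable X') (hY' : Measurable Y') :
    alphaPhi φ P Y = alphaPhi φ P' Y' ∧ betaPhi φ P Y = betaPhi φ P' Y' := by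
  have hF := h.ae_distFun_eq hX hY hX' hY'
  constructor
  · rw [alphaPhi_eq hφ hs h0 hY, alphaPhi_eq hφ hs h0 hY',
      integral_map_quantile hY (measurable_alphaAt_distFun hφ),
      integral_map_quantile hY' (measurable_alphaAt_distFun hφ)]
    exact integral_congr_ae (by filter_upwards [hF] with v hv; rw [hv])
  · rw [betaPhi_eq hφ hs h0 hY, betaPhi_eq hφ hs h0 hY',
      integral_map_quantile hY measurable_betaAt_distFun,
      integral_map_quantile hY' measurable_betaAt_distFun]
    exact integral_congr_ae (by filter_upwards [hF] with v hv; rw [hv])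

/-- `ξ_φ` and `Λ_φ` increase in the conditional convex order. -/
theorem CondConvexOrder.xiPhi_le_and_lambdaPhi_le (h : CondConvexOrder P Y X P' Y' X')
    (hφ : ConvexOn ℝ (Icc (-1) 1) φ) (hs : StrictConvexOnAt (Icc (-1) 1) φ 0) (h0 : φ 0 = 0)
    (hX : Measurable X) (hY : Measurable Y) (hX' : Measurable X') (hY' : Measurable Y')
    (hYnd : ¬ Degenerate P Y) :
    xiPhi φ P Y X ≤ xiPhi φ P' Y' X' ∧ lambdaPhi φ P Y X ≤ lambdaPhi φ P' Y' X' := by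
  have := Measure.isProbabilityMeasure_map (μ := P) hY.aemeasurable
  have := Measure.isProbabilityMeasure_map (μ := P') hY'.aemeasurable
  have hF := h.ae_distFun_eq hX hY hX' hY'
  have hmem : ∀ᵐ v ∂(volume.restrict (Ioo (0 : ℝ) 1)), v ∈ Ioo (0 : ℝ) 1 :=
    ae_restrict_mem measurableSet_Ioo
  obtain ⟨hα, hβ⟩ := h.normalizers_eq hφ hs h0 hX hY hX' hY'
  rw [xiPhi_eq hφ hX hY, xiPhi_eq hφ hX' hY', lambdaPhi_eq hφ hX hY, lambdaPhi_eq hφ hX' hY',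
    ← hα, ← hβ, integral_map_quantile hY (measurable_xiAt hφ hX),
    integral_map_quantile hY' (measurable_xiAt hφ hX'),
    integral_map_quantile hY (measurable_lambdaAt hφ hX),
    integral_map_quantile hY' (measurable_lambdaAt hφ hX')]
  refine ⟨mul_le_mul_of_nonneg_left (integral_mono_ae
      (integrable_comp_quantile hY (integrable_xiAt hφ hX _))
      (integrable_comp_quantile hY' (integrable_xiAt hφ hX' _)) ?_)
      (inv_nonneg.2 (alphaPhi_pos hφ hs h0 hY hYnd).le),
    mul_le_mul_of_nonneg_left (integral_mono_ae
      (integrable_comp_quantile hY (integrable_lambdaAt hφ hX _))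
      (integrable_comp_quantile hY' (integrable_lambdaAt hφ hX' _)) ?_)
      (inv_nonneg.2 (betaPhi_pos hφ hs h0 hY hYnd).le)⟩
  · filter_upwards [hF, hmem] with v hv hvm
    have := (h.convexOrder_condDistFun hX hY hX' hY' hvm hv).comp_sub_const
      (distFun P Y (quantile P Y v))
    unfold xiAt
    -- The centring constants agree at this level, so both sides are shifted by the same amount.
    rw [← hv]
    exact this.integral_le hφ ((measurable_condDistFun_comp hX _).sub_const _)
      (fun ω => sub_mem_Icc (condDistFun_mem _ _) (distFun_mem _))
      ((measurable_condDistFun_comp hX' _).sub_const _)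
      (fun ω => sub_mem_Icc (condDistFun_mem _ _) (distFun_mem _))
  · filter_upwards [hF, hmem] with v hv hvm
    have m1 := measurable_condDistFun_comp (P := P) (Y := Y) hX (quantile P Y v)
    have m2 := measurable_condDistFun_comp (P := P') (Y := Y') hX' (quantile P' Y' v)
    have := (h.convexOrder_condDistFun hX hY hX' hY' hvm hv).sub_copy m1
      (fun ω => condDistFun_mem _ _) m2 (fun ω => condDistFun_mem _ _)
    exact this.integral_le hφ ((m1.comp measurable_fst).sub (m1.comp measurable_snd))
      (fun z => sub_mem_Icc (condDistFun_mem _ _) (condDistFun_mem _ _))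
      ((m2.comp measurable_fst).sub (m2.comp measurable_snd))
      (fun z => sub_mem_Icc (condDistFun_mem _ _) (condDistFun_mem _ _))

end Monotonicity

section ConditionalIndependence

variable {G : Type*} [MeasurableSpace G] {Z : Ω → G}

lemma convexOrder_condDistFun_prodMk (hX : Measurable X) (hZ : Measurable Z) (hY : Measurable Y)
    (y : ℝ) : ConvexOrder P (fun ω => condDistFun P Y X (X ω) y)
      P (fun ω => condDistFun P Y (fun ω => (X ω, Z ω)) (X ω, Z ω) y) :=
  convexOrder_of_condExp hX.comap_le (measurable_condDistFun_comp (hX.prodMk hZ) y)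
    (fun _ => condDistFun_mem _ _) (condExp_condDistFun_prodMk hX hZ hY y)

lemma convexOrder_midpoint_prodMk (hX : Measurable X) (hZ : Measurable Z) (hY : Measurable Y)
    (y : ℝ) : ConvexOrder P (fun ω => condDistFun P Y X (X ω) y)
      P (fun ω => (condDistFun P Y X (X ω) y
        + condDistFun P Y (fun ω => (X ω, Z ω)) (X ω, Z ω) y) / 2) :=
  convexOrder_midpoint_of_condExp hX.comap_le (measurable_condDistFun_comp hX y)
    (fun _ => condDistFun_mem _ _) (measurable_condDistFun_comp (hX.prodMk hZ) y)
    (fun _ => condDistFun_mem _ _) (condExp_condDistFun_prodMk hX hZ hY y)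

lemma integral_eq_iff_ae_iff {μ : Measure ℝ} {A B : ℝ → ℝ} {Q : ℝ → Prop} {c : ℝ} (hc : 0 < c)
    (hA : Integrable A μ) (hB : Integrable B μ) (hle : ∀ y, A y ≤ B y)
    (hiff : ∀ y, A y = B y ↔ Q y) :
    c⁻¹ * ∫ y, A y ∂μ = c⁻¹ * ∫ y, B y ∂μ ↔ ∀ᵐ y ∂μ, Q y := by
  rw [mul_right_inj' (inv_ne_zero hc.ne'), integral_eq_iff_ae_eq_of_le hA hB hle]
  exact eventually_congr (Eventually.of_forall hiff)

/-- Adding `Z` to the explanatory variables leaves `ξ_φ` unchanged exactly under conditional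
independence. -/
theorem xiPhi_eq_prodMk_iff (hφ : StrictConvexOn ℝ (Icc (-1) 1) φ)
    (hs : StrictConvexOnAt (Icc (-1) 1) φ 0) (h0 : φ 0 = 0) (hX : Measurable X)
    (hZ : Measurable Z) (hY : Measurable Y) (hYnd : ¬ Degenerate P Y) :
    xiPhi φ P Y X = xiPhi φ P Y (fun ω => (X ω, Z ω)) ↔ CondIndepGiven P Y Z X := by
  have := Measure.isProbabilityMeasure_map (μ := P) hY.aemeasurable
  have hc := hφ.convexOn
  have hW : Measurable fun ω => (X ω, Z ω) := hX.prodMk hZ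
  rw [← ae_condDistFun_eq_iff_condIndepGiven hX hZ hY, xiPhi_eq hc hX hY, xiPhi_eq hc hW hY]
  refine integral_eq_iff_ae_iff (alphaPhi_pos hc hs h0 hY hYnd) (integrable_xiAt hc hX _)
    (integrable_xiAt hc hW _) (fun y => ?_) fun y => ⟨fun h => ?_, fun h => ?_⟩
  · exact ((convexOrder_condDistFun_prodMk hX hZ hY y).comp_sub_const _).integral_le hc
      ((measurable_condDistFun_comp hX y).sub_const _)
      (fun ω => sub_mem_Icc (condDistFun_mem _ _) (distFun_mem _))
      ((measurable_condDistFun_comp hW y).sub_const _)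
      (fun ω => sub_mem_Icc (condDistFun_mem _ _) (distFun_mem _))
  · exact ae_eq_of_integral_sub_const_eq hφ (measurable_condDistFun_comp hX y)
      (fun ω => condDistFun_mem _ _) (measurable_condDistFun_comp hW y)
      (fun ω => condDistFun_mem _ _) (convexOrder_midpoint_prodMk hX hZ hY y) (distFun_mem y) h
  · exact integral_congr_ae (by filter_upwards [h] with ω hω; rw [hω])

/-- Adding `Z` to the explanatory variables leaves `Λ_φ` unchanged exactly under conditional
independence. -/
theorem lambdaPhi_eq_prodMk_iff (hφ : StrictConvexOn ℝ (Icc (-1) 1) φ)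
    (hs : StrictConvexOnAt (Icc (-1) 1) φ 0) (h0 : φ 0 = 0) (hX : Measurable X)
    (hZ : Measurable Z) (hY : Measurable Y) (hYnd : ¬ Degenerate P Y) :
    lambdaPhi φ P Y X = lambdaPhi φ P Y (fun ω => (X ω, Z ω)) ↔ CondIndepGiven P Y Z X := by
  have := Measure.isProbabilityMeasure_map (μ := P) hY.aemeasurable
  have hc := hφ.convexOn
  have hW : Measurable fun ω => (X ω, Z ω) := hX.prodMk hZ
  rw [← ae_condDistFun_eq_iff_condIndepGiven hX hZ hY, lambdaPhi_eq hc hX hY, lambdaPhi_eq hc hW hY]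
  refine integral_eq_iff_ae_iff (betaPhi_pos hc hs h0 hY hYnd) (integrable_lambdaAt hc hX _)
    (integrable_lambdaAt hc hW _) (fun y => ?_) fun y => ?_
  all_goals
    have m1 := measurable_condDistFun_comp (P := P) (Y := Y) hX y
    have m2 := measurable_condDistFun_comp (P := P) (Y := Y) hW y
  · exact ((convexOrder_condDistFun_prodMk hX hZ hY y).sub_copy m1
      (fun ω => condDistFun_mem _ _) m2 (fun ω => condDistFun_mem _ _)).integral_le hc
      ((m1.comp measurable_fst).sub (m1.comp measurable_snd))
      (fun z => sub_mem_Icc (condDistFun_mem _ _) (condDistFun_mem _ _))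
      ((m2.comp measurable_fst).sub (m2.comp measurable_snd))
      (fun z => sub_mem_Icc (condDistFun_mem _ _) (condDistFun_mem _ _))
  · refine ⟨fun h => ?_, fun h => ?_⟩
    · exact ae_eq_of_integral_sub_copy_eq hφ m1 (fun ω => condDistFun_mem _ _) m2
        (fun ω => condDistFun_mem _ _) (convexOrder_midpoint_prodMk hX hZ hY y)
        ((integral_condDistFun hX hY y).trans (integral_condDistFun hW hY y).symm) h
    · have h1 := Measure.quasiMeasurePreserving_fst (μ := P) (ν := P) |>.ae h
      have h2 := Measure.quasiMeasurePreserving_snd (μ := P) (ν := P) |>.ae h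
      exact integral_congr_ae (by filter_upwards [h1, h2] with z hz1 hz2; rw [hz1, hz2])

end ConditionalIndependence

end MainResults

end DepMeasure

end

theorem theorem6
    (φ : ℝ → ℝ) (hφ : ConvexOn ℝ (Set.Icc (-1) 1) φ)
    (hφ_strict : DepMeasure.StrictConvexOnAt (Set.Icc (-1) 1) φ 0) (hφ_zero : φ 0 = 0)
    {Ω : Type*} [MeasurableSpace Ω] (P : Measure Ω) [IsProbabilityMeasure P]
    {p : ℕ} (Y : Ω → ℝ) (X : Ω → Fin p → ℝ) (hY : Measurable Y) (hX : Measurable X)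
    (hYnd : ¬ DepMeasure.Degenerate P Y) :
    -- both functionals are increasing in the conditional convex order
    (∀ (Ω' : Type*) [MeasurableSpace Ω'] (P' : Measure Ω') [IsProbabilityMeasure P']
        (p' : ℕ) (Y' : Ω' → ℝ) (X' : Ω' → Fin p' → ℝ), Measurable Y' → Measurable X' →
        DepMeasure.CondConvexOrder P Y X P' Y' X' →
          DepMeasure.xiPhi φ P Y X ≤ DepMeasure.xiPhi φ P' Y' X' ∧
          DepMeasure.lambdaPhi φ P Y X ≤ DepMeasure.lambdaPhi φ P' Y' X') ∧
    -- (i) values in the unit interval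
    (DepMeasure.xiPhi φ P Y X ∈ Set.Icc (0 : ℝ) 1 ∧
      DepMeasure.lambdaPhi φ P Y X ∈ Set.Icc (0 : ℝ) 1) ∧
    -- (ii) zero-independence and max-functionality
    ((DepMeasure.xiPhi φ P Y X = 0 ↔ IndepFun X Y P) ∧
      (DepMeasure.lambdaPhi φ P Y X = 0 ↔ IndepFun X Y P) ∧
      (DepMeasure.xiPhi φ P Y X = 1 ↔ DepMeasure.PerfectlyDependent P Y X) ∧
      (DepMeasure.lambdaPhi φ P Y X = 1 ↔ DepMeasure.PerfectlyDependent P Y X)) ∧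
    -- (iii) characterization of conditional independence
    (StrictConvexOn ℝ (Set.Icc (-1) 1) φ →
      ∀ (r : ℕ) (Z : Ω → Fin r → ℝ), Measurable Z →
        ((DepMeasure.lambdaPhi φ P Y X = DepMeasure.lambdaPhi φ P Y (fun ω => (X ω, Z ω)) ↔
            DepMeasure.xiPhi φ P Y X = DepMeasure.xiPhi φ P Y (fun ω => (X ω, Z ω))) ∧
          (DepMeasure.xiPhi φ P Y X = DepMeasure.xiPhi φ P Y (fun ω => (X ω, Z ω)) ↔
            DepMeasure.CondIndepGiven P Y Z X))) := by
  refine ⟨?_, ⟨?_, ?_⟩, ⟨?_, ?_, ?_, ?_⟩, ?_⟩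
  · intro Ω' _ P' _ p' Y' X' hY' hX' h
    exact h.xiPhi_le_and_lambdaPhi_le hφ hφ_strict hφ_zero hX hY hX' hY' hYnd
  · exact (DepMeasure.xiPhi_axioms hφ hφ_strict hφ_zero hX hY hYnd).1
  · exact (DepMeasure.lambdaPhi_axioms hφ hφ_strict hφ_zero hX hY hYnd).1
  · exact (DepMeasure.xiPhi_axioms hφ hφ_strict hφ_zero hX hY hYnd).2.1
  · exact (DepMeasure.lambdaPhi_axioms hφ hφ_strict hφ_zero hX hY hYnd).2.1
  · exact (DepMeasure.xiPhi_axioms hφ hφ_strict hφ_zero hX hY hYnd).2.2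
  · exact (DepMeasure.lambdaPhi_axioms hφ hφ_strict hφ_zero hX hY hYnd).2.2
  · intro hsc r Z hZ
    have hξ := DepMeasure.xiPhi_eq_prodMk_iff hsc hφ_strict hφ_zero hX hZ hY hYnd
    have hΛ := DepMeasure.lambdaPhi_eq_prodMk_iff hsc hφ_strict hφ_zero hX hZ hY hYnd
    exact ⟨hΛ.trans hξ.symm, hξ⟩
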